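/- **Theorem 1.3.** There is an absolute constant $\alpha_0>0$ such that for all real $C\ge 1$ and $0<\alpha<\alpha_0$ there are constants $C',c>0$, depending only on $C$ and $\alpha$, for which the following holds. Let $\mathbf F_q$ be a finite field with $q$ elements, let $n\ge 0$ be an integer, and let $F_1,\dots,F_n\subset\{1,\dots,n\}$ be index sets such that $|F_j|<\alpha n$ for every $j$ and every index $i\in\{1,\dots,n\}$ is contained in at most $(1-12\alpha)n$ of the sets $F_j$. Let $X_1,\dots,X_n$ be independent random vectors in $\mathbf F_q^n$ such that, for each $j$, the entries of $X_j$ with index outside $F_j$ are independent and each such entry $\xi$ is near uniform, that is, $\mathbf P(\xi=k)\le C/q$ for all $k\in\mathbf F_q$, while the entries of $X_j$ with index in $F_j$ are arbitrary (with any joint distribution) but jointly independent of the entries with index outside $F_j$. Let $M_n$ be the $n\times n$ matrix with columns $X_1,\dots,X_n$, let $Q(M_n)=n-\operatorname{rank}(M_n)$ be its corank, and let $Q_\infty$ be the random variable on $\{0,1,2,\dots\}$ with $$\mathbf P(Q_\infty=k)=\frac1{q^{k^2}}\,\frac{\prod_{i=k+1}^\infty(1-1/q^i)}{\prod_{i=1}^k(1-1/q^i)}.$$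 Then $$\|Q(M_n)-Q_\infty\|_{TV}\le\Big(\frac{C'}q\Big)^{cn},$$ where $\|Y-Z\|_{TV}=\sup_{A}|\mathbf P(Y\in A)-\mathbf P(Z\in A)|$, the supremum being over all sets $A$ of non-negative integers. -/

import Mathlib

open MeasureTheory ProbabilityTheory

namespace RankDist

/-! ### The limiting corank distribution -/

/-- The probability that the limiting corank equals `k`:
`q ^ (-k²) * ∏_{i ≥ k+1} (1 - q⁻ⁱ) / ∏_{i=1}^{k} (1 - q⁻ⁱ)`. -/
noncomputable def limitMass (q k : ℕ) : ℝ :=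
  1 / (q : ℝ) ^ (k ^ 2) *
    ((∏' i : ℕ, (1 - 1 / (q : ℝ) ^ (k + 1 + i))) / ∏ i ∈ Finset.Icc 1 k, (1 - 1 / (q : ℝ) ^ i))

/-- Infinite tail product, an auxiliary quantity for the proof that the masses add up to `1`. -/
noncomputable def tailProd (x : ℝ) (k : ℕ) : ℝ := ∏' i : ℕ, (1 - x ^ (k + 1 + i))

/-- Finite product, an auxiliary quantity for the proof that the masses add up to `1`. -/
noncomputable def headProd (x : ℝ) (k : ℕ) : ℝ := ∏ i ∈ Finset.range k, (1 - x ^ (i + 1))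

/-- Auxiliary masses; `m = 0` gives `limitMass`. -/
noncomputable def auxMass (x : ℝ) (m k : ℕ) : ℝ :=
  x ^ (k * (m + k)) * (tailProd x k / headProd x (m + k))

section Aux

variable {x : ℝ}

theorem summable_tail (h0 : 0 < x) (h1 : x < 1) (k : ℕ) :
    Summable (fun i : ℕ => -x ^ (k + 1 + i)) := by
  have := (summable_geometric_of_lt_one h0.le h1).mul_left (x ^ (k + 1))
  simpa [pow_add] using this.neg

theorem multipliable_tail (h0 : 0 < x) (h1 : x < 1) (k : ℕ) :
    Multipliable (fun i : ℕ => 1 - x ^ (k + 1 + i)) := by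
  have := Real.multipliable_one_add_of_summable (summable_tail h0 h1 k)
  simpa [sub_eq_add_neg] using this

theorem one_sub_pow_pos (h0 : 0 < x) (h1 : x < 1) (k : ℕ) : 0 < 1 - x ^ (k + 1) :=
  sub_pos.2 (pow_lt_one₀ h0.le h1 (Nat.succ_ne_zero k))

theorem tailProd_ne_zero (h0 : 0 < x) (h1 : x < 1) (k : ℕ) : tailProd x k ≠ 0 := by
  have := tprod_one_add_ne_zero_of_summable (f := fun i : ℕ => -x ^ (k + 1 + i)) (fun i => by
    have := one_sub_pow_pos h0 h1 (k + i)
    have e : k + 1 + i = k + i + 1 := by omega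
    rw [e]; intro h; linarith) (by simpa using (summable_tail h0 h1 k).norm)
  simpa [tailProd, sub_eq_add_neg] using this

theorem tailProd_succ (h0 : 0 < x) (h1 : x < 1) (k : ℕ) :
    tailProd x k = (1 - x ^ (k + 1)) * tailProd x (k + 1) := by
  unfold tailProd
  have h := tprod_eq_zero_mul' (f := fun i : ℕ => 1 - x ^ (k + 1 + i)) (by
    have := multipliable_tail h0 h1 (k + 1)
    refine this.congr fun i => ?_
    congr 2; omega)
  rw [h]
  congr 1
  refine tprod_congr fun i => ?_
  congr 2; omega

theorem tailProd_nonneg (h0 : 0 < x) (h1 : x < 1) (k : ℕ) : 0 ≤ tailProd x k := by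
  refine ge_of_tendsto' (multipliable_tail h0 h1 k).tendsto_prod_tprod_nat fun n => ?_
  refine Finset.prod_nonneg fun i _ => ?_
  exact sub_nonneg.2 (pow_le_one₀ h0.le h1.le)

theorem tailProd_pos (h0 : 0 < x) (h1 : x < 1) (k : ℕ) : 0 < tailProd x k :=
  lt_of_le_of_ne (tailProd_nonneg h0 h1 k) (tailProd_ne_zero h0 h1 k).symm

theorem tailProd_le_one (h0 : 0 < x) (h1 : x < 1) (k : ℕ) : tailProd x k ≤ 1 := by
  refine le_of_tendsto' (multipliable_tail h0 h1 k).tendsto_prod_tprod_nat fun n => ?_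
  refine Finset.prod_le_one (fun i _ => ?_) (fun i _ => ?_)
  · exact sub_nonneg.2 (pow_le_one₀ h0.le h1.le)
  · have := pow_pos h0 (k + 1 + i); linarith

theorem headProd_pos (h0 : 0 < x) (h1 : x < 1) (k : ℕ) : 0 < headProd x k :=
  Finset.prod_pos fun i _ => one_sub_pow_pos h0 h1 i

theorem headProd_succ (k : ℕ) : headProd x (k + 1) = headProd x k * (1 - x ^ (k + 1)) :=
  Finset.prod_range_succ _ _

theorem headProd_mul_tailProd (h0 : 0 < x) (h1 : x < 1) (k : ℕ) :
    headProd x k * tailProd x k = tailProd x 0 := by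
  induction k with
  | zero => simp [headProd]
  | succ k ih => rw [← ih, headProd_succ, tailProd_succ h0 h1 k]; ring

theorem le_headProd (h0 : 0 < x) (h1 : x < 1) (k : ℕ) : tailProd x 0 ≤ headProd x k := by
  rw [← headProd_mul_tailProd h0 h1 k]
  exact mul_le_of_le_one_right (headProd_pos h0 h1 k).le (tailProd_le_one h0 h1 k)

theorem auxMass_nonneg (h0 : 0 < x) (h1 : x < 1) (m k : ℕ) : 0 ≤ auxMass x m k :=
  mul_nonneg (pow_nonneg h0.le _)
    (div_nonneg (tailProd_nonneg h0 h1 k) (headProd_pos h0 h1 _).le)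

theorem auxMass_le (h0 : 0 < x) (h1 : x < 1) (m k : ℕ) :
    auxMass x m k ≤ x ^ (k * (m + k)) * (1 / tailProd x 0) := by
  unfold auxMass
  have := tailProd_pos h0 h1 0
  gcongr
  · exact tailProd_le_one h0 h1 k
  · exact le_headProd h0 h1 _

theorem auxMass_le_geom (h0 : 0 < x) (h1 : x < 1) (m k : ℕ) :
    auxMass x m k ≤ x ^ k * (1 / tailProd x 0) := by
  refine (auxMass_le h0 h1 m k).trans ?_
  have := tailProd_pos h0 h1 0
  refine mul_le_mul_of_nonneg_right (pow_le_pow_of_le_one h0.le h1.le ?_) (by positivity)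
  nlinarith [Nat.le_mul_self k, Nat.zero_le (k * m)]

theorem summable_geom_bound (h0 : 0 < x) (h1 : x < 1) :
    Summable (fun k : ℕ => x ^ k * (1 / tailProd x 0)) :=
  (summable_geometric_of_lt_one h0.le h1).mul_right _

theorem summable_auxMass (h0 : 0 < x) (h1 : x < 1) (m : ℕ) : Summable (auxMass x m) :=
  Summable.of_nonneg_of_le (auxMass_nonneg h0 h1 m) (auxMass_le_geom h0 h1 m)
    (summable_geom_bound h0 h1)

theorem auxMass_sub (h0 : 0 < x) (h1 : x < 1) (m k : ℕ) :
    auxMass x m k - auxMass x (m + 1) k =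
      (1 - x ^ k) * auxMass x m k - (1 - x ^ (k + 1)) * auxMass x m (k + 1) := by
  unfold auxMass
  have e : m + 1 + k = (m + k) + 1 := by omega
  have e' : m + (k + 1) = (m + k) + 1 := by omega
  rw [e, e', headProd_succ, tailProd_succ h0 h1 k]
  have p1 : k * (m + k + 1) = k * (m + k) + k := by ring
  have p2 : (k + 1) * (m + k + 1) = k * (m + k) + k + (m + k + 1) := by ring
  rw [p1, p2, pow_add x (k * (m + k) + k), pow_add x (k * (m + k)) k]
  have a := (headProd_pos h0 h1 (m + k)).ne'
  have b := (one_sub_pow_pos h0 h1 (m + k)).ne'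
  field_simp
  ring

theorem tsum_auxMass_succ (h0 : 0 < x) (h1 : x < 1) (m : ℕ) :
    ∑' k, auxMass x m k = ∑' k, auxMass x (m + 1) k := by
  have hs := summable_auxMass h0 h1 m
  have H := (hs.hasSum.sub (summable_auxMass h0 h1 (m + 1)).hasSum).tendsto_sum_nat
  have H' : Filter.Tendsto (fun N => ∑ k ∈ Finset.range N,
      (auxMass x m k - auxMass x (m + 1) k)) Filter.atTop (nhds 0) := by
    have hx : Filter.Tendsto (fun N : ℕ => -((1 - x ^ N) * auxMass x m N)) Filter.atTop
        (nhds (-((1 - 0) * 0))) :=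
      (((tendsto_pow_atTop_nhds_zero_of_lt_one h0.le h1).const_sub 1).mul
        hs.tendsto_atTop_zero).neg
    simp only [mul_zero, neg_zero] at hx
    refine hx.congr fun N => ?_
    simp_rw [auxMass_sub h0 h1]
    rw [Finset.sum_range_sub' (fun k => (1 - x ^ k) * auxMass x m k)]
    simp
  linarith [tendsto_nhds_unique H H']

theorem tsum_auxMass (h0 : 0 < x) (h1 : x < 1) : ∑' k, auxMass x 0 k = 1 := by
  have hc : ∀ m, ∑' k, auxMass x m k = ∑' k, auxMass x 0 k := fun m => by
    induction m with
    | zero => rfl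
    | succ m ih => rw [← tsum_auxMass_succ h0 h1 m, ih]
  have hlim : Filter.Tendsto (fun m => ∑' k, auxMass x m k) Filter.atTop
      (nhds (∑' k : ℕ, if k = 0 then (1 : ℝ) else 0)) := by
    refine tendsto_tsum_of_dominated_convergence (summable_geom_bound h0 h1) (fun k => ?_)
      (Filter.Eventually.of_forall fun m k => ?_)
    · rcases Nat.eq_zero_or_pos k with rfl | hk
      · have hh : Filter.Tendsto (fun m => headProd x m) Filter.atTop
            (nhds (tailProd x 0)) := by
          have := (multipliable_tail h0 h1 0).tendsto_prod_tprod_nat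
          simpa [headProd, tailProd, add_comm] using this
        have := (tendsto_const_nhds (x := tailProd x 0)).div hh (tailProd_ne_zero h0 h1 0)
        rw [div_self (tailProd_ne_zero h0 h1 0)] at this
        refine this.congr fun m => ?_
        simp [auxMass]
      · have hx : Filter.Tendsto (fun m : ℕ => x ^ m * (1 / tailProd x 0)) Filter.atTop
            (nhds (0 * (1 / tailProd x 0))) :=
          (tendsto_pow_atTop_nhds_zero_of_lt_one h0.le h1).mul_const _
        rw [zero_mul] at hx
        rw [if_neg hk.ne']
        refine squeeze_zero (fun m => auxMass_nonneg h0 h1 m k) (fun m => ?_) hx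
        refine (auxMass_le h0 h1 m k).trans ?_
        have := tailProd_pos h0 h1 0
        refine mul_le_mul_of_nonneg_right (pow_le_pow_of_le_one h0.le h1.le ?_) (by positivity)
        nlinarith
    · rw [Real.norm_of_nonneg (auxMass_nonneg h0 h1 m k)]
      exact auxMass_le_geom h0 h1 m k
  simp_rw [hc] at hlim
  rw [tsum_ite_eq] at hlim
  exact tendsto_nhds_unique tendsto_const_nhds hlim

end Aux

theorem limitMass_eq_auxMass (q k : ℕ) : limitMass q k = auxMass (1 / (q : ℝ)) 0 k := by
  unfold limitMass auxMass tailProd headProd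
  have h : ∏ i ∈ Finset.Icc 1 k, (1 - 1 / (q : ℝ) ^ i) =
      ∏ i ∈ Finset.range k, (1 - (1 / (q : ℝ)) ^ (i + 1)) := by
    rw [← Finset.Ico_add_one_right_eq_Icc, Finset.prod_Ico_eq_prod_range]
    refine Finset.prod_congr (by simp) fun i _ => ?_
    rw [one_div_pow, add_comm]
  rw [h]
  simp [sq]

theorem hasSum_limitMass {q : ℕ} (hq : 1 < q) :
    HasSum (fun k => ENNReal.ofReal (limitMass q k)) 1 := by
  have hq' : (1 : ℝ) < q := by exact_mod_cast hq
  have h0 : 0 < 1 / (q : ℝ) := by positivity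
  have h1 : 1 / (q : ℝ) < 1 := (div_lt_one (by positivity)).2 hq'
  simp_rw [limitMass_eq_auxMass]
  rw [ENNReal.summable.hasSum_iff, ← ENNReal.ofReal_tsum_of_nonneg (auxMass_nonneg h0 h1 0)
    (summable_auxMass h0 h1 0), tsum_auxMass h0 h1, ENNReal.ofReal_one]

/-- The law of the limiting random variable `Q_∞` on `ℕ`. -/
noncomputable def limitLaw (q : ℕ) (hq : 1 < q) : PMF ℕ :=
  ⟨fun k => ENNReal.ofReal (limitMass q k), hasSum_limitMass hq⟩

/-! ### Total variation distance, near uniform vectors, and coranks -/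

/-- Total variation distance of two probability measures: the supremum over all events of the
difference of the probabilities. -/
noncomputable def tvDist {S : Type*} [MeasurableSpace S] (μ ν : Measure S) : ℝ :=
  ⨆ A : {A : Set S // MeasurableSet A}, |μ.real A.1 - ν.real A.1|

/-- A random element `ξ` of a finite field of order `q` is near uniform with constant `C` if
`P (ξ = k) ≤ C / q` for all `k`. -/
def IsNearUniform {Ω K : Type*} [MeasurableSpace Ω] [Fintype K] (P : Measure Ω) (C : ℝ)
    (ξ : Ω → K) : Prop :=
  ∀ k : K, P.real {ω | ξ ω = k} ≤ C / (Fintype.card K : ℝ)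

/-- A near uniform random vector of type `F`: the entries with index outside `F` are independent
and near uniform, and the entries with index in `F` are arbitrary (with any joint law), but
independent of the others. -/
structure IsNearUniformOfType {Ω K : Type*} [MeasurableSpace Ω] [Fintype K] [MeasurableSpace K]
    {n : ℕ} (P : Measure Ω) (C : ℝ) (F : Finset (Fin n)) (X : Ω → Fin n → K) : Prop where
  nearUniform : ∀ j, j ∉ F → IsNearUniform P C (fun ω => X ω j)
  indep : iIndepFun (fun (j : {j // j ∉ F}) (ω : Ω) => X ω j) P
  indep_arbitrary :
    IndepFun (fun (ω : Ω) (j : {j // j ∉ F}) => X ω j) (fun (ω : Ω) (j : {j // j ∈ F}) => X ω j) P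

/-- The size condition on the index sets `F₁, …, Fₙ`. -/
structure IndexCondition {n : ℕ} (α : ℝ) (F : Fin n → Finset (Fin n)) : Prop where
  card_lt : ∀ j, ((F j).card : ℝ) < α * n
  mem_le : ∀ i, ((Finset.univ.filter fun j => i ∈ F j).card : ℝ) ≤ (1 - 12 * α) * n

/-- The corank of the square matrix with columns `x₁, …, xₙ`. -/
noncomputable def corank {K : Type*} [Field K] {n : ℕ} (x : Fin n → Fin n → K) : ℕ :=
  n - (Matrix.of fun i j => x j i).rank

end RankDist

namespace RankDist

/-- One step, on observables, of the chain on `ℕ` that stays at `d` with probability `x ^ d` and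
moves to `d - 1` otherwise. -/
noncomputable def idealStep (x : ℝ) (h : ℕ → ℝ) (d : ℕ) : ℝ := x ^ d * h d + (1 - x ^ d) * h (d - 1)

section Chain

variable {x : ℝ}

theorem idealStep_mem (h0 : 0 < x) (h1 : x < 1) {h : ℕ → ℝ} (hh : ∀ d, h d ∈ Set.Icc (0 : ℝ) 1)
    (d : ℕ) : idealStep x h d ∈ Set.Icc (0 : ℝ) 1 := by
  have a := pow_nonneg h0.le d
  have b := pow_le_one₀ h0.le h1.le (n := d)
  exact convex_Icc (0 : ℝ) 1 (hh d) (hh (d - 1)) a (sub_nonneg.2 b) (by ring)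

theorem iterate_idealStep_mem (h0 : 0 < x) (h1 : x < 1) {h : ℕ → ℝ}
    (hh : ∀ d, h d ∈ Set.Icc (0 : ℝ) 1) (s d : ℕ) :
    (idealStep x)^[s] h d ∈ Set.Icc (0 : ℝ) 1 := by
  induction s generalizing d with
  | zero => exact hh d
  | succ s ih => rw [Function.iterate_succ_apply']; exact idealStep_mem h0 h1 ih d

theorem auxMass_zero_right (h0 : 0 < x) (h1 : x < 1) (m : ℕ) : auxMass x m 0 = tailProd x m := by
  have := (headProd_pos h0 h1 m).ne'
  rw [auxMass, ← headProd_mul_tailProd h0 h1 m]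
  simp [mul_div_cancel_left₀ _ this]

theorem auxMass_zero_step (h0 : 0 < x) (h1 : x < 1) (m : ℕ) :
    auxMass x m 0 = auxMass x (m + 1) 0 * (1 - x ^ (m + 1)) := by
  rw [auxMass_zero_right h0 h1, auxMass_zero_right h0 h1, tailProd_succ h0 h1 m]; ring

theorem auxMass_succ_step (h0 : 0 < x) (h1 : x < 1) (m k : ℕ) :
    auxMass x m (k + 1) = auxMass x (m + 1) k * x ^ (m + 1 + k) +
      auxMass x (m + 1) (k + 1) * (1 - x ^ (m + 1 + (k + 1))) := by
  unfold auxMass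
  have e : m + (k + 1) = m + k + 1 := by omega
  have e' : m + 1 + (k + 1) = m + k + 1 + 1 := by omega
  have e2 : m + 1 + k = m + k + 1 := by omega
  rw [e, e', e2, headProd_succ (m + k + 1), tailProd_succ h0 h1 k]
  have a := (headProd_pos h0 h1 (m + k + 1)).ne'
  have b := (one_sub_pow_pos h0 h1 (m + k + 1)).ne'
  field_simp
  ring

theorem tsum_auxMass_eq_one (h0 : 0 < x) (h1 : x < 1) (m : ℕ) : ∑' k, auxMass x m k = 1 := by
  induction m with
  | zero => exact tsum_auxMass h0 h1
  | succ m ih => rw [← tsum_auxMass_succ h0 h1 m, ih]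

theorem summable_auxMass_mul (h0 : 0 < x) (h1 : x < 1) (m : ℕ) {g : ℕ → ℝ}
    (hg : ∀ k, g k ∈ Set.Icc (0 : ℝ) 1) : Summable fun k => auxMass x m k * g k :=
  Summable.of_nonneg_of_le (fun k => mul_nonneg (auxMass_nonneg h0 h1 m k) (hg k).1)
    (fun k => mul_le_of_le_one_right (auxMass_nonneg h0 h1 m k) (hg k).2)
    (summable_auxMass h0 h1 m)

theorem tsum_auxMass_mul_idealStep (h0 : 0 < x) (h1 : x < 1) (m : ℕ) {h : ℕ → ℝ}
    (hh : ∀ d, h d ∈ Set.Icc (0 : ℝ) 1) :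
    ∑' k, auxMass x (m + 1) k * idealStep x h (m + 1 + k) = ∑' k, auxMass x m k * h (m + k) := by
  have hp : ∀ d, x ^ d ∈ Set.Icc (0 : ℝ) 1 := fun d =>
    ⟨pow_nonneg h0.le d, pow_le_one₀ h0.le h1.le⟩
  have hf : Summable fun k => auxMass x (m + 1) k * (x ^ (m + 1 + k) * h (m + 1 + k)) :=
    summable_auxMass_mul h0 h1 _ fun k =>
      ⟨mul_nonneg (hp _).1 (hh _).1, mul_le_one₀ (hp _).2 (hh _).1 (hh _).2⟩
  have hg : Summable fun k => auxMass x (m + 1) k * ((1 - x ^ (m + 1 + k)) * h (m + k)) :=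
    summable_auxMass_mul h0 h1 _ fun k =>
      ⟨mul_nonneg (sub_nonneg.2 (hp _).2) (hh _).1,
        mul_le_one₀ (sub_le_self _ (hp _).1) (hh _).1 (hh _).2⟩
  have e : ∀ k, auxMass x (m + 1) k * idealStep x h (m + 1 + k) =
      auxMass x (m + 1) k * (x ^ (m + 1 + k) * h (m + 1 + k)) +
        auxMass x (m + 1) k * ((1 - x ^ (m + 1 + k)) * h (m + k)) := fun k => by
    have : m + 1 + k - 1 = m + k := by omega
    rw [idealStep, this]; ring
  simp_rw [e]
  rw [hf.tsum_add hg, hg.tsum_eq_zero_add,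
    (summable_auxMass_mul h0 h1 m fun k => hh (m + k)).tsum_eq_zero_add, add_left_comm,
    ← hf.tsum_add ((summable_nat_add_iff 1).2 hg)]
  congr 1
  · rw [auxMass_zero_step h0 h1 m]; simp [mul_assoc]
  · refine tsum_congr fun k => ?_
    rw [auxMass_succ_step h0 h1 m k]
    have : m + 1 + k = m + (k + 1) := by omega
    rw [this]; ring

theorem tsum_auxMass_mul_iterate (h0 : 0 < x) (h1 : x < 1) {h : ℕ → ℝ}
    (hh : ∀ d, h d ∈ Set.Icc (0 : ℝ) 1) (s : ℕ) :
    ∑' k, auxMass x s k * (idealStep x)^[s] h (s + k) = ∑' k, auxMass x 0 k * h k := by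
  induction s with
  | zero => simp
  | succ s ih =>
    rw [← ih, ← tsum_auxMass_mul_idealStep h0 h1 s (iterate_idealStep_mem h0 h1 hh s)]
    simp_rw [Function.iterate_succ_apply']

theorem one_sub_tailProd_le (h0 : 0 < x) (h1 : x ≤ 1 / 2) (s : ℕ) :
    1 - tailProd x s ≤ 2 * x ^ (s + 1) := by
  have h1' : x < 1 := by linarith
  have hN : ∀ N, 1 - 2 * x ^ (s + 1) + 2 * x ^ (s + 1 + N) ≤
      ∏ i ∈ Finset.range N, (1 - x ^ (s + 1 + i)) := fun N => by
    induction N with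
    | zero => simp
    | succ N ih =>
      rw [Finset.prod_range_succ]
      have hp : 0 ≤ x ^ (s + 1 + N) := pow_nonneg h0.le _
      have hle : ∏ i ∈ Finset.range N, (1 - x ^ (s + 1 + i)) ≤ 1 :=
        Finset.prod_le_one (fun i _ => sub_nonneg.2 (pow_le_one₀ h0.le h1'.le))
          fun i _ => sub_le_self _ (pow_nonneg h0.le _)
      rw [← add_assoc, pow_succ x (s + 1 + N)]
      nlinarith [mul_nonneg hp (sub_nonneg.2 hle)]
  have := ge_of_tendsto' (multipliable_tail h0 h1' s).tendsto_prod_tprod_nat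
    (b := 1 - 2 * x ^ (s + 1)) fun N => by
      have := hN N
      have := pow_nonneg h0.le (s + 1 + N)
      linarith
  rw [tailProd]; linarith

theorem abs_tsum_auxMass_sub_iterate_le (h0 : 0 < x) (h1 : x ≤ 1 / 2) {h : ℕ → ℝ}
    (hh : ∀ d, h d ∈ Set.Icc (0 : ℝ) 1) (s : ℕ) :
    |∑' k, auxMass x 0 k * h k - (idealStep x)^[s] h s| ≤ 2 * x ^ (s + 1) := by
  have h1' : x < 1 := by linarith
  have hm := iterate_idealStep_mem h0 h1' hh s
  refine le_trans ?_ (one_sub_tailProd_le h0 h1 s)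
  rw [← tsum_auxMass_mul_iterate h0 h1' hh s, ← auxMass_zero_right h0 h1' s]
  have hs := summable_auxMass_mul h0 h1' s fun k => hm (s + k)
  have ht := summable_auxMass h0 h1' s
  have e1 := tsum_auxMass_eq_one h0 h1' s
  rw [ht.tsum_eq_zero_add] at e1
  rw [hs.tsum_eq_zero_add, ← e1, add_sub_cancel_left, add_zero]
  have hb0 : 0 ≤ ∑' k, auxMass x s (k + 1) * (idealStep x)^[s] h (s + (k + 1)) :=
    tsum_nonneg fun k => mul_nonneg (auxMass_nonneg h0 h1' _ _) (hm _).1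
  have hb1 : ∑' k, auxMass x s (k + 1) * (idealStep x)^[s] h (s + (k + 1)) ≤
      ∑' k, auxMass x s (k + 1) :=
    Summable.tsum_le_tsum (fun k => mul_le_of_le_one_right (auxMass_nonneg h0 h1' _ _) (hm _).2)
      ((summable_nat_add_iff 1).2 hs) ((summable_nat_add_iff 1).2 ht)
  have hc := hm s
  have ha := auxMass_nonneg h0 h1' s 0
  have e : auxMass x s 0 = 1 - ∑' k, auxMass x s (k + 1) := by linarith
  rw [abs_le]
  constructor <;> nlinarith [hc.1, hc.2]

end Chain

theorem exists_addChar_ne_one (K : Type*) [Field K] [Fintype K] :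
    ∃ ψ : AddChar K ℂ, ∃ a, ψ a ≠ 1 := by
  obtain ⟨ψ, h⟩ := (AddChar.exists_apply_ne_zero (a := (1 : K))).2 one_ne_zero
  exact ⟨ψ, 1, h⟩

section Span

variable {K V : Type*} [Field K] [AddCommGroup V] [Module K V]

theorem sum_submodule_addChar {ψ : AddChar K ℂ} (hψ : ∃ a, ψ a ≠ 1)
    (U : Submodule K (Module.Dual K V)) [Fintype U] (x : V) [Decidable (∀ w ∈ U, w x = 0)] :
    ∑ w : U, ψ (w.1 x) = if ∀ w ∈ U, w x = 0 then (Fintype.card U : ℂ) else 0 := by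
  split_ifs with h
  · simp [fun w : U => h w.1 w.2]
  · push Not at h
    obtain ⟨w, hw, hx⟩ := h
    obtain ⟨a, ha⟩ := hψ
    let χ : AddChar U ℂ := ψ.compAddMonoidHom
      (AddMonoidHom.mk' (fun w : U => w.1 x) fun _ _ => rfl)
    refine AddChar.sum_eq_zero_of_ne_one (ψ := χ) fun hχ => ha ?_
    have := DFunLike.congr_fun hχ (⟨(a / w x) • w, U.smul_mem _ hw⟩ : U)
    simpa [χ, hx] using this

theorem finrank_sup_span_singleton [FiniteDimensional K V] {W : Submodule K V} {x : V}
    (hx : x ∉ W) :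
    Module.finrank K ↥(W ⊔ Submodule.span K {x}) = Module.finrank K W + 1 := by
  have h0 : x ≠ 0 := fun h => hx (h ▸ W.zero_mem)
  have hd : W ⊓ Submodule.span K {x} = ⊥ := by
    rw [← disjoint_iff, Submodule.disjoint_span_singleton' h0]; exact hx
  have := Submodule.finrank_sup_add_finrank_inf_eq W (Submodule.span K {x})
  rwa [hd, finrank_bot, finrank_span_singleton h0, add_zero] at this

theorem sup_span_singleton_of_mem {W : Submodule K V} {x : V} (hx : x ∈ W) :
    W ⊔ Submodule.span K {x} = W :=
  sup_eq_left.2 ((Submodule.span_singleton_le_iff_mem _ _).2 hx)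

end Span

section Fourier

variable {K V : Type*} [Field K] [Fintype K] [AddCommGroup V] [Module K V] [Fintype V]

/-- The Fourier coefficient at a linear form `w` of a weight `p` on a finite vector space. -/
noncomputable def fourierCoeff (ψ : AddChar K ℂ) (p : V → ℝ) (w : Module.Dual K V) : ℂ :=
  ∑ x, (p x : ℂ) * ψ (w x)

theorem natCard_dualAnnihilator (W : Submodule K V) :
    Nat.card W.dualAnnihilator =
      Fintype.card K ^ (Module.finrank K V - Module.finrank K W) := by
  have := Subspace.finrank_add_finrank_dualAnnihilator_eq W
  rw [Module.natCard_eq_pow_finrank (K := K), Nat.card_eq_fintype_card]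
  congr 1
  omega

theorem abs_sum_submodule_sub_le {ψ : AddChar K ℂ} (hψ : ∃ a, ψ a ≠ 1) {p : V → ℝ}
    (hp : ∑ x, p x = 1) (W : Submodule K V) [DecidablePred (· ∈ W)] {η : ℝ} (hη : 0 ≤ η)
    (h : ∀ w ∈ W.dualAnnihilator, w ≠ 0 → ‖fourierCoeff ψ p w‖ ≤ η) :
    |(∑ x, if x ∈ W then p x else 0) -
      (1 / (Fintype.card K : ℝ)) ^ (Module.finrank K V - Module.finrank K W)| ≤ η := by
  classical
  have : Finite (Module.Dual K V) := Finite.of_injective _ DFunLike.coe_injective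
  let _ : Fintype W.dualAnnihilator := Fintype.ofFinite _
  set N : ℕ := Fintype.card K ^ (Module.finrank K V - Module.finrank K W) with hN
  have hcard : Fintype.card W.dualAnnihilator = N := by
    rw [← Nat.card_eq_fintype_card, natCard_dualAnnihilator]
  have hN0 : (0 : ℝ) < N := by rw [← hcard]; exact_mod_cast Fintype.card_pos
  have key : ∑ w : W.dualAnnihilator, fourierCoeff ψ p w.1 =
      (((N : ℝ) * ∑ x, if x ∈ W then p x else 0 : ℝ) : ℂ) := by
    simp_rw [fourierCoeff]
    rw [Finset.sum_comm]
    simp_rw [← Finset.mul_sum, sum_submodule_addChar hψ,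
      Subspace.forall_mem_dualAnnihilator_apply_eq_zero_iff, hcard]
    push_cast
    rw [Finset.mul_sum]
    refine Finset.sum_congr rfl fun x _ => ?_
    split_ifs <;> simp [mul_comm]
  have h0 : fourierCoeff ψ p 0 = 1 := by simp [fourierCoeff, ← Complex.ofReal_sum, hp]
  rw [← Finset.add_sum_erase _ _ (Finset.mem_univ (0 : W.dualAnnihilator)),
    Submodule.coe_zero, h0] at key
  have hb : ‖∑ w ∈ Finset.univ.erase (0 : W.dualAnnihilator), fourierCoeff ψ p w.1‖ ≤ N * η := by
    refine (norm_sum_le_of_le _ fun w hw => h w.1 w.2 ?_).trans ?_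
    · simpa using (Finset.mem_erase.1 hw).1
    · rw [Finset.sum_const, nsmul_eq_mul]
      refine mul_le_mul_of_nonneg_right ?_ hη
      rw [← hcard]
      exact_mod_cast Finset.card_le_univ _
  have e : ∑ w ∈ Finset.univ.erase (0 : W.dualAnnihilator), fourierCoeff ψ p w.1 =
      (((N : ℝ) * (∑ x, if x ∈ W then p x else 0) - 1 : ℝ) : ℂ) := by
    rw [Complex.ofReal_sub, ← key]; simp
  rw [e, Complex.norm_real, Real.norm_eq_abs] at hb
  have e2 : (1 / (Fintype.card K : ℝ)) ^ (Module.finrank K V - Module.finrank K W) = 1 / N := by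
    rw [hN, one_div_pow]; push_cast; rfl
  rw [e2]
  have e3 : (N : ℝ) * (∑ x, if x ∈ W then p x else 0) - 1 =
      N * ((∑ x, if x ∈ W then p x else 0) - 1 / N) := by field_simp
  rw [e3, abs_mul, abs_of_pos hN0] at hb
  exact le_of_mul_le_mul_left hb hN0

theorem sum_norm_sq_fourierCoeff {ψ : AddChar K ℂ} (hψ : ∃ a, ψ a ≠ 1) (p : V → ℝ)
    [Fintype (Module.Dual K V)] :
    ∑ w, ‖fourierCoeff ψ p w‖ ^ 2 =
      (Fintype.card K : ℝ) ^ Module.finrank K V * ∑ x, p x ^ 2 := by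
  classical
  let _ : Fintype (⊤ : Submodule K (Module.Dual K V)) := Fintype.ofFinite _
  have orth : ∀ z : V, ∑ w : Module.Dual K V, ψ (w z) =
      if z = 0 then ((Fintype.card K : ℂ) ^ Module.finrank K V) else 0 := fun z => by
    have h := sum_submodule_addChar hψ (⊤ : Submodule K (Module.Dual K V)) z
    have h1 : ∑ w : (⊤ : Submodule K (Module.Dual K V)), ψ (w.1 z) =
        ∑ w : Module.Dual K V, ψ (w z) :=
      Fintype.sum_equiv Submodule.topEquiv.toEquiv _ _ fun w => rfl
    rw [← h1, h]
    have hc : Fintype.card (⊤ : Submodule K (Module.Dual K V)) =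
        Fintype.card K ^ Module.finrank K V := by
      rw [Module.card_eq_pow_finrank (K := K), finrank_top, Subspace.dual_finrank_eq]
    have hz : (∀ w ∈ (⊤ : Submodule K (Module.Dual K V)), w z = 0) ↔ z = 0 := by
      simpa using Module.forall_dual_apply_eq_zero_iff K z
    simp only [hz, hc]
    push_cast; rfl
  have e : ∀ w, ((‖fourierCoeff ψ p w‖ ^ 2 : ℝ) : ℂ) =
      ∑ x, ∑ y, (p x : ℂ) * p y * ψ (w (x - y)) := fun w => by
    push_cast
    rw [← Complex.mul_conj', fourierCoeff, map_sum, Finset.sum_mul_sum]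
    refine Finset.sum_congr rfl fun x _ => Finset.sum_congr rfl fun y _ => ?_
    rw [map_mul, Complex.conj_ofReal, ← AddChar.map_neg_eq_conj, map_sub, sub_eq_add_neg,
      AddChar.map_add_eq_mul]
    ring
  rw [← Complex.ofReal_inj]
  rw [Complex.ofReal_sum]
  simp_rw [e]
  rw [Finset.sum_comm]
  push_cast
  rw [Finset.mul_sum]
  refine Finset.sum_congr rfl fun x _ => ?_
  rw [Finset.sum_comm]
  simp_rw [← Finset.mul_sum, orth, sub_eq_zero]
  simp
  ring

theorem card_fourierCoeff_gt_le {ψ : AddChar K ℂ} (hψ : ∃ a, ψ a ≠ 1) {p : V → ℝ}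
    (hp0 : ∀ x, 0 ≤ p x) (hp : ∑ x, p x = 1) [Fintype (Module.Dual K V)] {η ε : ℝ} (hη : 0 < η)
    (hε : ∀ x, p x ≤ ε) [DecidablePred fun w : Module.Dual K V => η < ‖fourierCoeff ψ p w‖] :
    ((Finset.univ.filter fun w : Module.Dual K V => η < ‖fourierCoeff ψ p w‖).card : ℝ) ≤
      (Fintype.card K : ℝ) ^ Module.finrank K V * ε / η ^ 2 := by
  rw [le_div_iff₀ (by positivity)]
  calc _ = ∑ w ∈ Finset.univ.filter (fun w : Module.Dual K V => η < ‖fourierCoeff ψ p w‖),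
        η ^ 2 := by simp
    _ ≤ ∑ w ∈ Finset.univ.filter (fun w : Module.Dual K V => η < ‖fourierCoeff ψ p w‖),
        ‖fourierCoeff ψ p w‖ ^ 2 := Finset.sum_le_sum fun w hw =>
          pow_le_pow_left₀ hη.le (Finset.mem_filter.1 hw).2.le 2
    _ ≤ ∑ w, ‖fourierCoeff ψ p w‖ ^ 2 :=
        Finset.sum_le_sum_of_subset_of_nonneg (Finset.filter_subset _ _) fun _ _ _ => by positivity
    _ = _ := sum_norm_sq_fourierCoeff hψ p
    _ ≤ _ := by
        refine mul_le_mul_of_nonneg_left ?_ (by positivity)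
        calc ∑ x, p x ^ 2 ≤ ∑ x, p x * ε := Finset.sum_le_sum fun x _ => by
              rw [sq]; exact mul_le_mul_of_nonneg_left (hε x) (hp0 x)
          _ = ε := by rw [← Finset.sum_mul, hp, one_mul]

end Fourier

section Walk

variable {K V J : Type*} [Field K] [AddCommGroup V] [Module K V] [Fintype V]

/-- The expectation of `f` at the subspace spanned by `W` and independent random vectors with
laws `p j`, where `j` runs through the list. -/
noncomputable def walk (p : J → V → ℝ) : List J → (Submodule K V → ℝ) → Submodule K V → ℝ
  | [], f, W => f W
  | j :: L, f, W => ∑ x, p j x * walk p L f (W ⊔ Submodule.span K {x})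

theorem walk_append (p : J → V → ℝ) (L L' : List J) (f : Submodule K V → ℝ) (W : Submodule K V) :
    walk p (L ++ L') f W = walk p L (walk p L' f) W := by
  induction L generalizing W with
  | nil => rfl
  | cons j L ih => simp [walk, ih]

variable {p : J → V → ℝ}

theorem walk_mono (hp : ∀ j x, 0 ≤ p j x) (L : List J) {f g : Submodule K V → ℝ}
    (h : ∀ U, f U ≤ g U) (W : Submodule K V) : walk p L f W ≤ walk p L g W := by
  induction L generalizing W with
  | nil => exact h W
  | cons j L ih => exact Finset.sum_le_sum fun x _ => mul_le_mul_of_nonneg_left (ih _) (hp j x)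

theorem walk_add (L : List J) (f g : Submodule K V → ℝ) (W : Submodule K V) :
    walk p L (fun U => f U + g U) W = walk p L f W + walk p L g W := by
  induction L generalizing W with
  | nil => rfl
  | cons j L ih => simp [walk, ih, mul_add, Finset.sum_add_distrib]

theorem walk_const (hp : ∀ j, ∑ x, p j x = 1) (L : List J) (c : ℝ) (W : Submodule K V) :
    walk p L (fun _ => c) W = c := by
  induction L generalizing W with
  | nil => rfl
  | cons j L ih => simp [walk, ih, ← Finset.sum_mul, hp]

theorem walk_neg (L : List J) (f : Submodule K V → ℝ) (W : Submodule K V) :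
    walk p L (fun U => -f U) W = -walk p L f W := by
  induction L generalizing W with
  | nil => rfl
  | cons j L ih => simp [walk, ih]

theorem walk_sum {T : Type*} (s : Finset T) (L : List J) (f : T → Submodule K V → ℝ)
    (W : Submodule K V) :
    walk p L (fun U => ∑ t ∈ s, f t U) W = ∑ t ∈ s, walk p L (f t) W := by
  induction L generalizing W with
  | nil => rfl
  | cons j L ih =>
    simp only [walk, ih, Finset.mul_sum]
    exact Finset.sum_comm

theorem abs_walk_sub_le (hp0 : ∀ j x, 0 ≤ p j x) (hp : ∀ j, ∑ x, p j x = 1) (L : List J)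
    {f g : Submodule K V → ℝ} {c : ℝ} (h : ∀ U, |f U - c| ≤ g U) (W : Submodule K V) :
    |walk p L f W - c| ≤ walk p L g W := by
  have e : walk p L f W - c = walk p L (fun U => f U + -c) W := by
    rw [walk_add, walk_const hp]; ring
  rw [e, abs_le, ← walk_neg]
  exact ⟨walk_mono hp0 L (fun U => by linarith [(abs_le.1 (h U)).1]) W,
    walk_mono hp0 L (fun U => by linarith [(abs_le.1 (h U)).2]) W⟩

open Classical in
theorem walk_le_ker (L : List J) (w : Module.Dual K V) (W : Submodule K V) :
    walk p L (fun U => if U ≤ LinearMap.ker w then 1 else 0) W =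
      if W ≤ LinearMap.ker w then
        (L.map fun j => ∑ x, if x ∈ LinearMap.ker w then p j x else 0).prod else 0 := by
  induction L generalizing W with
  | nil => simp [walk]
  | cons j L ih =>
    simp only [walk, ih, sup_le_iff, Submodule.span_singleton_le_iff_mem, List.map_cons,
      List.prod_cons]
    split_ifs with h
    · rw [Finset.sum_mul]
      refine Finset.sum_congr rfl fun x _ => ?_
      simp [h]
    · simp [h]

open Classical in
/-- The probability that the vectors are dependent modulo `W` is small if every subspace that
occurs has small measure. -/
theorem walk_finrank_ne_le [FiniteDimensional K V] (hp0 : ∀ j x, 0 ≤ p j x)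
    (hp : ∀ j, ∑ x, p j x = 1) {ε : ℝ} (hε : 0 ≤ ε) (L : List J) (W : Submodule K V) (m : ℕ)
    (hm : Module.finrank K W + L.length = m)
    (h : ∀ j ∈ L, ∀ U : Submodule K V, Module.finrank K U < m →
      (∑ x, if x ∈ U then p j x else 0) ≤ ε) :
    walk p L (fun U => if Module.finrank K U = m then 0 else 1) W ≤ L.length * ε := by
  induction L generalizing W with
  | nil => simp only [List.length_nil, add_zero] at hm; simp [walk, hm]
  | cons j L ih =>
    rw [List.length_cons] at hm
    have hW := h j (by simp) W (by omega)
    calc walk p (j :: L) (fun U => if Module.finrank K U = m then 0 else 1) W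
        ≤ ∑ x, ((if x ∈ W then p j x else 0) + p j x * (L.length * ε)) := by
          refine Finset.sum_le_sum fun x _ => ?_
          have hn : 0 ≤ p j x * (L.length * ε) := by have := hp0 j x; positivity
          by_cases hx : x ∈ W
          · rw [if_pos hx]
            have : walk p L (fun U : Submodule K V => if Module.finrank K U = m then (0 : ℝ) else 1)
                (W ⊔ Submodule.span K {x}) ≤ 1 := by
              refine (walk_mono hp0 L (g := fun _ => 1) (fun U => ?_) _).trans_eq
                (walk_const hp L 1 _)
              split_ifs <;> norm_num
            have := mul_le_of_le_one_right (hp0 j x) this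
            linarith
          · rw [if_neg hx, zero_add]
            refine mul_le_mul_of_nonneg_left (ih _ ?_ fun i hi => h i (by simp [hi])) (hp0 j x)
            rw [finrank_sup_span_singleton hx]; omega
      _ ≤ _ := by
          rw [Finset.sum_add_distrib, ← Finset.sum_mul, hp, one_mul, List.length_cons]
          push_cast; linarith

open Classical in
/-- If all nonzero forms that vanish on `W` have small Fourier coefficients, then the dimension of
the growing subspace behaves like that for uniform vectors. -/
theorem abs_walk_sub_iterate_le [Fintype K] {ψ : AddChar K ℂ} (hψ : ∃ a, ψ a ≠ 1)
    (hp0 : ∀ j x, 0 ≤ p j x) (hp : ∀ j, ∑ x, p j x = 1) {η : ℝ} (hη : 0 ≤ η) {h : ℕ → ℝ}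
    (hh : ∀ d, h d ∈ Set.Icc (0 : ℝ) 1) (L : List J) (W : Submodule K V)
    (hW : ∀ j ∈ L, ∀ w ∈ W.dualAnnihilator, w ≠ 0 → ‖fourierCoeff ψ (p j) w‖ ≤ η) :
    |walk p L (fun U => h (Module.finrank K V - Module.finrank K U)) W -
      (idealStep (1 / (Fintype.card K : ℝ)))^[L.length] h
        (Module.finrank K V - Module.finrank K W)| ≤ L.length * η := by
  induction L generalizing W with
  | nil => simp [walk]
  | cons j L ih =>
    set x₀ : ℝ := 1 / (Fintype.card K : ℝ) with hx₀
    set d := Module.finrank K V - Module.finrank K W with hd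
    set H := (idealStep x₀)^[L.length] h with hH
    have hq : (1 : ℝ) < Fintype.card K := by exact_mod_cast Fintype.one_lt_card
    have hHm : ∀ d, H d ∈ Set.Icc (0 : ℝ) 1 :=
      iterate_idealStep_mem (by positivity) ((div_lt_one (by positivity)).2 hq) hh _
    have ih' : ∀ x, |walk p L (fun U => h (Module.finrank K V - Module.finrank K U))
        (W ⊔ Submodule.span K {x}) - (if x ∈ W then H d else H (d - 1))| ≤ L.length * η := by
      intro x
      have := ih (W ⊔ Submodule.span K {x}) fun i hi w hw => hW i (by simp [hi]) w
        (Submodule.dualAnnihilator_anti le_sup_left hw)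
      split_ifs with hx
      · rw [sup_span_singleton_of_mem hx] at this ⊢
        exact this
      · rw [finrank_sup_span_singleton hx, ← Nat.sub_sub] at this
        exact this
    have hP := abs_sum_submodule_sub_le hψ (hp j) W hη (hW j (by simp))
    set P := ∑ x, if x ∈ W then p j x else 0 with hPdef
    have e1 : ∑ x, p j x * (if x ∈ W then H d else H (d - 1)) = P * H d + (1 - P) * H (d - 1) := by
      have : ∀ x, p j x * (if x ∈ W then H d else H (d - 1)) =
          (if x ∈ W then p j x else 0) * (H d - H (d - 1)) + p j x * H (d - 1) := fun x => by
        split_ifs <;> ring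
      simp_rw [this]
      rw [Finset.sum_add_distrib, ← Finset.sum_mul, ← Finset.sum_mul, hp, ← hPdef]
      ring
    have e2 : |∑ x, p j x * walk p L (fun U => h (Module.finrank K V - Module.finrank K U))
        (W ⊔ Submodule.span K {x}) - (P * H d + (1 - P) * H (d - 1))| ≤ L.length * η := by
      rw [← e1, ← Finset.sum_sub_distrib]
      refine (Finset.abs_sum_le_sum_abs _ _).trans ?_
      calc _ ≤ ∑ x, p j x * (L.length * η) := Finset.sum_le_sum fun x _ => by
            rw [← mul_sub, abs_mul, abs_of_nonneg (hp0 j x)]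
            exact mul_le_mul_of_nonneg_left (ih' x) (hp0 j x)
        _ = _ := by rw [← Finset.sum_mul, hp, one_mul]
    have e3 : |(P * H d + (1 - P) * H (d - 1)) - idealStep x₀ H d| ≤ η := by
      have : (P * H d + (1 - P) * H (d - 1)) - idealStep x₀ H d =
          (P - x₀ ^ d) * (H d - H (d - 1)) := by rw [idealStep]; ring
      rw [this, abs_mul]
      refine (mul_le_of_le_one_right (abs_nonneg _) ?_).trans hP
      rw [abs_le]
      constructor <;> linarith [(hHm d).1, (hHm d).2, (hHm (d - 1)).1, (hHm (d - 1)).2]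
    rw [List.length_cons, Function.iterate_succ_apply', ← hH]
    push_cast
    calc _ ≤ _ := abs_sub_le _ (P * H d + (1 - P) * H (d - 1)) _
      _ ≤ _ := by rw [add_mul, one_mul]; exact add_le_add e2 e3

theorem walk_ofFn (p : J → V → ℝ) (f : Submodule K V → ℝ) {n : ℕ} (g : Fin n → J)
    (W : Submodule K V) :
    walk p (List.ofFn g) f W =
      ∑ x : Fin n → V, (∏ j, p (g j) (x j)) * f (W ⊔ Submodule.span K (Set.range x)) := by
  induction n generalizing W with
  | zero => simp [walk]
  | succ n ih =>
    rw [List.ofFn_succ, walk, ← (Fin.consEquiv fun _ => V).sum_comp, Fintype.sum_prod_type]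
    refine Finset.sum_congr rfl fun x _ => ?_
    rw [ih, Finset.mul_sum]
    refine Finset.sum_congr rfl fun y _ => ?_
    simp [Fin.consEquiv, Fin.prod_univ_succ, Fin.range_cons, Submodule.span_insert, sup_assoc,
      mul_assoc]

end Walk

section Coordinates

variable {K : Type*} [Field K] {n : ℕ}

theorem corank_eq_sub_finrank_span (x : Fin n → Fin n → K) :
    corank x = n - Module.finrank K (Submodule.span K (Set.range x)) := by
  rw [corank, Matrix.rank_eq_finrank_span_cols]
  rfl

theorem exists_coordinate_complement (W : Submodule K (Fin n → K)) :
    ∃ D : Finset (Fin n), D.card = n - Module.finrank K W ∧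
      ∀ z ∈ W, (∀ i ∉ D, z i = 0) → z = 0 := by
  classical
  obtain ⟨κ, a, ha, hs, hl⟩ := exists_linearIndependent' K
    fun i : Fin n => W.mkQ (Pi.single i 1)
  have : Fintype κ := Fintype.ofInjective a ha
  have htop : Submodule.span K (Set.range fun i : Fin n => W.mkQ (Pi.single i 1)) = ⊤ := by
    have e : (Set.range fun i : Fin n => W.mkQ (Pi.single i 1)) =
        W.mkQ '' Set.range (Pi.basisFun K (Fin n)) := by
      rw [← Set.range_comp]; congr 1; ext i; simp
    rw [e, Submodule.span_image, (Pi.basisFun K (Fin n)).span_eq, Submodule.map_top,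
      Submodule.range_mkQ]
  refine ⟨Finset.univ.image a, ?_, fun z hz h => ?_⟩
  · rw [Finset.card_image_of_injective _ ha, Finset.card_univ, ← finrank_span_eq_card hl, hs, htop,
      finrank_top]
    have := Submodule.finrank_quotient_add_finrank W
    rw [Module.finrank_fin_fun] at this
    omega
  · have h1 : ∑ k, z (a k) • W.mkQ (Pi.single (a k) 1) = 0 := by
      rw [← Finset.sum_image (s := Finset.univ) (g := a)
        (f := fun i => z i • W.mkQ (Pi.single i 1)) ha.injOn,
        Finset.sum_subset (Finset.subset_univ _) fun i _ hi => by rw [h i hi, zero_smul]]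
      simp_rw [← map_smul]
      rw [← map_sum, pi_eq_sum_univ' z |>.symm]
      simpa using hz
    have h2 := Fintype.linearIndependent_iff.1 hl _ h1
    ext i
    by_cases hi : i ∈ Finset.univ.image a
    · obtain ⟨k, -, rfl⟩ := Finset.mem_image.1 hi
      exact h2 k
    · exact h i hi

end Coordinates

section Spread

variable {K : Type*} {n : ℕ}

/-- A weight `p` on `Kⁿ` is spread off `F` with constant `ε` if conditionally on the other
coordinates, any set `D` of coordinates outside `F` takes each value with probability at
most `ε ^ |D|`. -/
def IsSpread (p : (Fin n → K) → ℝ) (ε : ℝ) (F : Finset (Fin n)) : Prop :=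
  ∀ D : Finset (Fin n), Disjoint D F → ∀ S : Finset (Fin n → K),
    (∀ x ∈ S, ∀ y ∈ S, (∀ i ∉ D, x i = y i) → x = y) → ∑ x ∈ S, p x ≤ ε ^ D.card

variable {p : (Fin n → K) → ℝ} {ε : ℝ} {F : Finset (Fin n)}

theorem IsSpread.apply_le (h : IsSpread p ε F) (x : Fin n → K) : p x ≤ ε ^ (n - F.card) := by
  simpa [Finset.card_compl] using h Fᶜ disjoint_compl_left {x} (by simp)

variable [Field K] [Fintype K]

open Classical in
theorem IsSpread.sum_ker_le (h : IsSpread p ε F) {w : Module.Dual K (Fin n → K)} {i : Fin n}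
    (hi : i ∉ F) (hw : w (Pi.single i 1) ≠ 0) :
    (∑ x, if x ∈ LinearMap.ker w then p x else 0) ≤ ε := by
  rw [← Finset.sum_filter]
  have := h {i} (by simpa using hi) (Finset.univ.filter fun x => x ∈ LinearMap.ker w)
    fun x hx y hy hxy => ?_
  · simpa using this
  · simp only [LinearMap.mem_ker, Finset.mem_filter, Finset.mem_univ, true_and,
      Finset.mem_singleton] at hx hy hxy
    have e : x - y = (x i - y i) • Pi.single i (1 : K) := by
      ext k
      by_cases hk : k = i
      · subst hk; simp
      · simp [hk, hxy k hk]
    have hz : w (x - y) = 0 := by rw [map_sub, hx, hy, sub_zero]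
    rw [e, map_smul, smul_eq_mul, mul_eq_zero, or_iff_left hw] at hz
    rw [← sub_eq_zero, e, hz, zero_smul]

open Classical in
theorem IsSpread.sum_submodule_le (h : IsSpread p ε F) (h0 : 0 ≤ ε) (h1 : ε ≤ 1)
    (W : Submodule K (Fin n → K)) :
    (∑ x, if x ∈ W then p x else 0) ≤ ε ^ (n - Module.finrank K W - F.card) := by
  obtain ⟨D, hD, hW⟩ := exists_coordinate_complement W
  rw [← Finset.sum_filter]
  refine (h (D \ F) Finset.sdiff_disjoint _ fun x hx y hy hxy => ?_).trans
    (pow_le_pow_of_le_one h0 h1 ?_)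
  · simp only [Finset.mem_filter, Finset.mem_univ, true_and] at hx hy
    refine sub_eq_zero.1 (hW _ (W.sub_mem hx hy) fun i hi => sub_eq_zero.2 (hxy i ?_))
    simp [hi]
  · rw [← hD]; exact Finset.le_card_sdiff _ _

end Spread

section Law

variable {Ω K : Type*} [MeasurableSpace Ω] [Fintype K] [MeasurableSpace K]
  [MeasurableSingletonClass K] {P : Measure Ω} {n : ℕ} {C : ℝ}
  {F : Finset (Fin n)} {X : Ω → Fin n → K}

theorem IsNearUniformOfType.real_eq_mul_prod (h : IsNearUniformOfType P C F X)
    {T : Finset (Fin n)} (hT : Disjoint T F) (x : Fin n → K) :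
    P.real {ω | (∀ i ∈ F, X ω i = x i) ∧ ∀ i ∈ T, X ω i = x i} =
      P.real {ω | ∀ i ∈ F, X ω i = x i} * ∏ i ∈ T, P.real {ω | X ω i = x i} := by
  classical
  set T' : Finset {j // j ∉ F} := T.subtype (· ∉ F)
  have h1 := h.indep_arbitrary.measure_inter_preimage_eq_mul
    {y | ∀ i ∈ T', y i = x i} {y | ∀ i, y i = x i} (Set.toFinite _).measurableSet
    (Set.toFinite _).measurableSet
  have h2 := h.indep.meas_biInter (S := T') (s := fun i => {ω | X ω i = x i})
    fun i _ => ⟨{x i}, measurableSet_singleton _, rfl⟩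
  have hT' : ∀ ω, (∀ i ∈ T', X ω i = x i) ↔ ∀ i ∈ T, X ω i = x i := fun ω => by
    refine ⟨fun H i hi => H ⟨i, Finset.disjoint_left.1 hT hi⟩ (by simpa [T'] using hi),
      fun H i hi => H i ?_⟩
    simpa [T'] using hi
  have e1 : {ω | (∀ i ∈ F, X ω i = x i) ∧ ∀ i ∈ T, X ω i = x i} =
      (fun (ω : Ω) (j : {j // j ∉ F}) => X ω j) ⁻¹' {y | ∀ i ∈ T', y i = x i} ∩
        (fun (ω : Ω) (j : {j // j ∈ F}) => X ω j) ⁻¹' {y | ∀ i, y i = x i} := by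
    ext ω
    rw [Set.mem_ofPred_eq, ← hT' ω, and_comm]
    simp
  have e2 : (fun (ω : Ω) (j : {j // j ∉ F}) => X ω j) ⁻¹' {y | ∀ i ∈ T', y i = x i} =
      ⋂ i ∈ T', {ω | X ω i = x i} := by
    ext ω; simp
  have e3 : (fun (ω : Ω) (j : {j // j ∈ F}) => X ω j) ⁻¹' {y | ∀ i, y i = x i} =
      {ω | ∀ i ∈ F, X ω i = x i} := by
    ext ω; simp
  have e4 : ∏ i ∈ T', P {ω | X ω i = x i} = ∏ i ∈ T, P {ω | X ω i = x i} :=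
    Finset.prod_subtype_of_mem (fun i => P {ω | X ω i = x i}) fun i hi =>
      Finset.disjoint_left.1 hT hi
  rw [← e1, e2, e3, h2, e4] at h1
  simp only [measureReal_def]
  rw [h1, ENNReal.toReal_mul, ENNReal.toReal_prod, mul_comm]

variable [IsProbabilityMeasure P]

theorem sum_real_fiber_eq_one (hX : Measurable X) : ∑ x, P.real {ω | X ω = x} = 1 := by
  have := sum_measureReal_preimage_singleton (μ := P) (f := X) Finset.univ
    fun y _ => hX (measurableSet_singleton y)
  simpa [Set.preimage, probReal_univ] using this

variable [Field K]

theorem IsNearUniformOfType.isSpread (h : IsNearUniformOfType P C F X) (hX : Measurable X) :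
    IsSpread (fun x => P.real {ω | X ω = x}) (C / (Fintype.card K : ℝ)) F := by
  classical
  intro D hD S hS
  set E : (Fin n → K) → Set Ω := fun x =>
    {ω | (∀ i ∈ F, X ω i = x i) ∧ ∀ i ∈ Fᶜ \ D, X ω i = x i} with hE
  have hc0 : 0 ≤ C / (Fintype.card K : ℝ) ∨ D = ∅ := by
    rcases D.eq_empty_or_nonempty with h0 | ⟨i, hi⟩
    · exact Or.inr h0
    · exact Or.inl (measureReal_nonneg.trans
        (h.nearUniform i (Finset.disjoint_left.1 hD hi) 0))
  have hpow : 0 ≤ (C / (Fintype.card K : ℝ)) ^ D.card := by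
    rcases hc0 with h0 | rfl
    · positivity
    · simp
  have hx : ∀ x, P.real {ω | X ω = x} ≤ (C / (Fintype.card K : ℝ)) ^ D.card * P.real (E x) := by
    intro x
    have e : {ω | X ω = x} = {ω | (∀ i ∈ F, X ω i = x i) ∧ ∀ i ∈ Fᶜ, X ω i = x i} := by
      ext ω
      simp only [Set.mem_ofPred_eq, funext_iff, Finset.mem_compl]
      exact ⟨fun H => ⟨fun i _ => H i, fun i _ => H i⟩, fun H i => by
        by_cases hi : i ∈ F
        exacts [H.1 i hi, H.2 i hi]⟩
    have hDF : D ⊆ Fᶜ := fun i hi => Finset.mem_compl.2 (Finset.disjoint_left.1 hD hi)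
    rw [e, h.real_eq_mul_prod disjoint_compl_left, hE,
      h.real_eq_mul_prod (disjoint_compl_left.mono_left Finset.sdiff_subset),
      ← Finset.prod_sdiff hDF, ← mul_assoc, mul_comm]
    refine mul_le_mul_of_nonneg_right ?_
      (mul_nonneg measureReal_nonneg (Finset.prod_nonneg fun _ _ => measureReal_nonneg))
    rw [← Finset.prod_const]
    exact Finset.prod_le_prod (fun _ _ => measureReal_nonneg) fun i hi =>
      h.nearUniform i (Finset.disjoint_left.1 hD hi) _
  have hmE : ∀ x, MeasurableSet (E x) := fun x =>
    hX (Set.toFinite {y : Fin n → K | (∀ i ∈ F, y i = x i) ∧ ∀ i ∈ Fᶜ \ D, y i = x i}).measurableSet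
  have hdisj : (S : Set (Fin n → K)).PairwiseDisjoint E := by
    intro x hx y hy hxy
    refine Set.disjoint_left.2 fun ω h1 h2 => hxy (hS x hx y hy fun i hi => ?_)
    by_cases hF : i ∈ F
    · rw [← h1.1 i hF, h2.1 i hF]
    · have : i ∈ Fᶜ \ D := by simp [hF, hi]
      rw [← h1.2 i this, h2.2 i this]
  calc ∑ x ∈ S, P.real {ω | X ω = x}
      ≤ ∑ x ∈ S, (C / (Fintype.card K : ℝ)) ^ D.card * P.real (E x) :=
        Finset.sum_le_sum fun x _ => hx x
    _ = (C / (Fintype.card K : ℝ)) ^ D.card * P.real (⋃ x ∈ S, E x) := by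
        rw [← Finset.mul_sum, measureReal_biUnion_finset hdisj fun x _ => hmE x]
    _ ≤ _ := mul_le_of_le_one_right hpow measureReal_le_one

/-- The law of the corank as an expectation over the growing span of the columns. -/
theorem real_map_corank_eq_walk {Y : Fin n → Ω → Fin n → K} (hY : ∀ j, Measurable (Y j))
    (hi : iIndepFun Y P) (A : Set ℕ) :
    (P.map fun ω => corank fun j => Y j ω).real A =
      walk (fun j x => P.real {ω | Y j ω = x}) (List.finRange n)
        (fun U : Submodule K (Fin n → K) => A.indicator (fun _ => (1 : ℝ))
          (Module.finrank K (Fin n → K) - Module.finrank K U)) ⊥ := by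
  classical
  have hm : Measurable fun ω => (fun j => Y j ω : Fin n → Fin n → K) :=
    measurable_pi_lambda _ hY
  have hc : Measurable (corank : (Fin n → Fin n → K) → ℕ) := measurable_of_countable _
  have hcm : Measurable fun ω => corank fun j => Y j ω := hc.comp hm
  rw [map_measureReal_apply hcm MeasurableSet.of_discrete]
  have e : (fun ω => corank fun j => Y j ω) ⁻¹' A =
      ⋃ x ∈ Finset.univ.filter (fun x : Fin n → Fin n → K => corank x ∈ A),
        {ω | ∀ j, Y j ω = x j} := by
    ext ω
    simp only [Set.mem_preimage, Set.mem_iUnion, Finset.mem_filter, Finset.mem_univ, true_and,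
      Set.mem_ofPred_eq, exists_prop]
    refine ⟨fun H => ⟨_, H, fun _ => rfl⟩, ?_⟩
    rintro ⟨x, hx, H⟩
    rwa [show (fun j => Y j ω) = x from funext H]
  have hmx : ∀ x : Fin n → Fin n → K, P.real {ω | ∀ j, Y j ω = x j} =
      ∏ j, P.real {ω | Y j ω = x j} := fun x => by
    have := hi.meas_iInter (s := fun j => {ω | Y j ω = x j})
      fun j => ⟨{x j}, measurableSet_singleton _, rfl⟩
    simp only [measureReal_def]
    rw [Set.ofPred_forall, this, ENNReal.toReal_prod]
  rw [e, measureReal_biUnion_finset, Finset.sum_filter, ← List.ofFn_id, walk_ofFn]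
  · refine Finset.sum_congr rfl fun x _ => ?_
    rw [bot_sup_eq, Module.finrank_fin_fun, ← corank_eq_sub_finrank_span, hmx]
    simp [Set.indicator_apply]
  · intro x _ y _ hxy
    exact Set.disjoint_left.2 fun ω h1 h2 => hxy (funext fun j => (h1 j).symm.trans (h2 j))
  · intro x _
    rw [Set.ofPred_forall]
    exact MeasurableSet.iInter fun j => hY j (measurableSet_singleton _)

theorem real_toMeasure_limitLaw {q : ℕ} (hq : 1 < q) (A : Set ℕ) :
    (limitLaw q hq).toMeasure.real A =
      ∑' k, auxMass (1 / (q : ℝ)) 0 k * A.indicator (fun _ => (1 : ℝ)) k := by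
  have hq' : (1 : ℝ) < q := by exact_mod_cast hq
  have h0 : 0 < 1 / (q : ℝ) := by positivity
  have h1 : 1 / (q : ℝ) < 1 := (div_lt_one (by positivity)).2 hq'
  rw [measureReal_def, PMF.toMeasure_apply_eq_tsum, ENNReal.tsum_toReal_eq]
  · refine tsum_congr fun k => ?_
    by_cases hk : k ∈ A
    · simp only [hk, Set.indicator_of_mem, mul_one]
      change (ENNReal.ofReal (limitMass q k)).toReal = _
      rw [limitMass_eq_auxMass, ENNReal.toReal_ofReal (auxMass_nonneg h0 h1 0 k)]
    · simp [hk]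
  · intro k
    by_cases hk : k ∈ A
    · simp only [hk, Set.indicator_of_mem]
      exact PMF.apply_ne_top _ _
    · simp [hk]

end Law

section Support

variable {K : Type*} [Field K] {n : ℕ}

open Classical in
/-- The indices of the basis vectors at which a linear form does not vanish. -/
noncomputable def formSupport (w : Module.Dual K (Fin n → K)) : Finset (Fin n) :=
  Finset.univ.filter fun i => w (Pi.single i 1) ≠ 0

theorem mem_formSupport {w : Module.Dual K (Fin n → K)} {i : Fin n} :
    i ∈ formSupport w ↔ w (Pi.single i 1) ≠ 0 := by
  simp [formSupport]

theorem formSupport_nonempty {w : Module.Dual K (Fin n → K)} (hw : w ≠ 0) :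
    (formSupport w).Nonempty := by
  by_contra h
  rw [Finset.not_nonempty_iff_eq_empty] at h
  refine hw ((Pi.basisFun K (Fin n)).ext fun i => ?_)
  have := mt mem_formSupport.2 (h ▸ Finset.notMem_empty i)
  simpa using this

variable [Fintype K] [Fintype (Module.Dual K (Fin n → K))]

open Classical in
theorem card_formSupport_lt_le (t : ℝ) :
    ((Finset.univ.filter fun w : Module.Dual K (Fin n → K) =>
      ((formSupport w).card : ℝ) < t).card : ℝ) ≤ 2 ^ n * (Fintype.card K : ℝ) ^ t := by
  have hq : (1 : ℝ) ≤ Fintype.card K := by exact_mod_cast Fintype.card_pos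
  have hS : ∀ S : Finset (Fin n), (Finset.univ.filter fun w : Module.Dual K (Fin n → K) =>
      formSupport w = S).card ≤ Fintype.card K ^ S.card := fun S => by
    have : Fintype.card K ^ S.card = (Finset.univ : Finset (S → K)).card := by simp
    rw [this]
    refine Finset.card_le_card_of_injOn (fun w i => w (Pi.single i.1 1)) (by simp) ?_
    intro w hw w' hw' h
    simp only [Finset.coe_filter, Finset.mem_univ, true_and, Set.mem_ofPred_eq] at hw hw'
    refine (Pi.basisFun K (Fin n)).ext fun i => ?_
    rw [Pi.basisFun_apply]
    by_cases hi : i ∈ S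
    · exact congr_fun h ⟨i, hi⟩
    · have h1 := mt mem_formSupport.2 (hw ▸ hi)
      have h2 := mt mem_formSupport.2 (hw' ▸ hi)
      rw [not_not] at h1 h2
      rw [h1, h2]
  have hsub : (Finset.univ.filter fun w : Module.Dual K (Fin n → K) =>
      ((formSupport w).card : ℝ) < t) ⊆
      (Finset.univ.filter fun S : Finset (Fin n) => (S.card : ℝ) < t).biUnion fun S =>
        Finset.univ.filter fun w : Module.Dual K (Fin n → K) => formSupport w = S := by
    intro w hw
    simpa using hw
  calc _ ≤ ((∑ S ∈ Finset.univ.filter fun S : Finset (Fin n) => (S.card : ℝ) < t,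
        Fintype.card K ^ S.card : ℕ) : ℝ) := by
        exact_mod_cast (Finset.card_le_card hsub).trans
          (Finset.card_biUnion_le.trans (Finset.sum_le_sum fun S _ => hS S))
    _ ≤ ∑ S ∈ Finset.univ.filter fun S : Finset (Fin n) => (S.card : ℝ) < t,
        (Fintype.card K : ℝ) ^ t := by
        push_cast
        refine Finset.sum_le_sum fun S hS => ?_
        rw [← Real.rpow_natCast]
        exact Real.rpow_le_rpow_of_exponent_le hq (Finset.mem_filter.1 hS).2.le
    _ ≤ _ := by
        rw [Finset.sum_const, nsmul_eq_mul]
        refine mul_le_mul_of_nonneg_right ?_ (by positivity)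
        have : (Finset.univ.filter fun S : Finset (Fin n) => (S.card : ℝ) < t).card ≤ 2 ^ n := by
          refine (Finset.card_le_univ _).trans ?_
          simp
        exact_mod_cast this

end Support

section Core

variable {K : Type*} [Field K] [Fintype K] {n : ℕ} {p : Fin n → (Fin n → K) → ℝ} {ε : ℝ}
  {F : Fin n → Finset (Fin n)}

open Classical in
theorem prod_ker_le (hp0 : ∀ j x, 0 ≤ p j x) (hp : ∀ j, ∑ x, p j x = 1)
    (hs : ∀ j, IsSpread (p j) ε (F j)) (L : List (Fin n)) (w : Module.Dual K (Fin n → K)) :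
    (L.map fun j => ∑ x, if x ∈ LinearMap.ker w then p j x else 0).prod ≤
      ε ^ L.countP fun j => ¬ formSupport w ⊆ F j := by
  induction L with
  | nil => simp
  | cons j L ih =>
    have h0 : ∀ j, 0 ≤ ∑ x, if x ∈ LinearMap.ker w then p j x else 0 := fun j =>
      Finset.sum_nonneg fun x _ => by split_ifs; exacts [hp0 j x, le_rfl]
    have hL0 : 0 ≤ (L.map fun j => ∑ x, if x ∈ LinearMap.ker w then p j x else 0).prod :=
      List.prod_nonneg fun a ha => by
        obtain ⟨i, -, rfl⟩ := List.mem_map.1 ha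
        exact h0 i
    rw [List.map_cons, List.prod_cons, List.countP_cons]
    by_cases hj : formSupport w ⊆ F j
    · simp only [hj, not_true_eq_false, decide_false, Bool.false_eq_true, if_false, add_zero]
      refine (mul_le_of_le_one_left hL0 ?_).trans ih
      rw [← hp j]
      refine Finset.sum_le_sum fun x _ => ?_
      split_ifs
      exacts [le_rfl, hp0 j x]
    · simp only [hj, not_false_eq_true, decide_true, if_true]
      obtain ⟨i, hi, hiF⟩ := Finset.not_subset.1 hj
      have h1 := (hs j).sum_ker_le hiF (mem_formSupport.1 hi)
      rw [pow_succ, mul_comm]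
      exact mul_le_mul ih h1 (h0 j) (hL0.trans ih)

open Classical in
/-- Expose first the vectors with indices in `L`, then those with indices in `L'`. The three error
terms come from linear dependence of the first vectors, from linear forms in `B` that vanish on
all of them, and from the remaining steps. -/
theorem abs_walk_append_sub_iterate_le {ψ : AddChar K ℂ} (hψ : ∃ a, ψ a ≠ 1)
    (hp0 : ∀ j x, 0 ≤ p j x) (hp : ∀ j, ∑ x, p j x = 1) (hε0 : 0 ≤ ε) {η : ℝ} (hη : 0 ≤ η)
    {h : ℕ → ℝ} (hh : ∀ d, h d ∈ Set.Icc (0 : ℝ) 1) (L L' : List (Fin n))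
    (hLL : L.length + L'.length = n)
    (hdep : ∀ j ∈ L, ∀ U : Submodule K (Fin n → K), Module.finrank K U < L.length →
      (∑ x, if x ∈ U then p j x else 0) ≤ ε)
    (B : Finset (Module.Dual K (Fin n → K)))
    (hB : ∀ w ∉ B, w ≠ 0 → ∀ j ∈ L', ‖fourierCoeff ψ (p j) w‖ ≤ η) :
    |walk p (L ++ L') (fun U : Submodule K (Fin n → K) =>
        h (Module.finrank K (Fin n → K) - Module.finrank K U)) ⊥ -
      (idealStep (1 / (Fintype.card K : ℝ)))^[L'.length] h L'.length| ≤
      L.length * ε +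
        ∑ w ∈ B, (L.map fun j => ∑ x, if x ∈ LinearMap.ker w then p j x else 0).prod +
          L'.length * η := by
  have hq : (1 : ℝ) < Fintype.card K := by exact_mod_cast Fintype.one_lt_card
  have hI := iterate_idealStep_mem (x := 1 / (Fintype.card K : ℝ)) (by positivity)
    ((div_lt_one (by positivity)).2 hq) hh L'.length L'.length
  have hw : ∀ U : Submodule K (Fin n → K),
      walk p L' (fun U => h (Module.finrank K (Fin n → K) - Module.finrank K U)) U ∈
        Set.Icc (0 : ℝ) 1 := fun U =>
    ⟨(walk_const hp L' 0 U).symm.trans_le (walk_mono hp0 L' (fun U => (hh _).1) U),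
      (walk_mono hp0 L' (fun U => (hh _).2) U).trans_eq (walk_const hp L' 1 U)⟩
  rw [walk_append]
  refine (abs_walk_sub_le hp0 hp L (g := fun U : Submodule K (Fin n → K) =>
    ((if Module.finrank K U = L.length then 0 else 1) + ∑ w ∈ B, if U ≤ LinearMap.ker w then 1 else 0) + L'.length * η) (fun U => ?_) ⊥).trans ?_
  · have hn1 : 0 ≤ ∑ w ∈ B, if U ≤ LinearMap.ker w then (1 : ℝ) else 0 :=
      Finset.sum_nonneg fun _ _ => by split_ifs <;> norm_num
    have hn2 : 0 ≤ L'.length * η := by positivity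
    have hn3 : (0 : ℝ) ≤ if Module.finrank K U = L.length then 0 else 1 := by
      split_ifs <;> norm_num
    have htriv : |walk p L' (fun U => h (Module.finrank K (Fin n → K) - Module.finrank K U)) U -
        (idealStep (1 / (Fintype.card K : ℝ)))^[L'.length] h L'.length| ≤ 1 := by
      rw [abs_le]
      constructor <;> linarith [hI.1, hI.2, (hw U).1, (hw U).2]
    by_cases hU : Module.finrank K U = L.length
    · by_cases hUB : ∃ w ∈ B, U ≤ LinearMap.ker w
      · obtain ⟨w, hwB, hwU⟩ := hUB
        have := Finset.single_le_sum (f := fun w => if U ≤ LinearMap.ker w then (1 : ℝ) else 0)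
          (fun _ _ => by split_ifs <;> norm_num) hwB
        simp only [hwU, if_true] at this
        linarith
      · push Not at hUB
        have := abs_walk_sub_iterate_le hψ hp0 hp hη hh L' U fun j hj w hwU hw0 =>
          hB w (fun hwB => hUB w hwB fun x hx => (Submodule.mem_dualAnnihilator w).1 hwU x hx)
            hw0 j hj
        have e : Module.finrank K (Fin n → K) - Module.finrank K U = L'.length := by
          rw [Module.finrank_fin_fun, hU]; omega
        rw [e] at this
        linarith
    · rw [if_neg hU]; linarith
  · rw [walk_add, walk_add, walk_const hp, walk_sum]
    simp_rw [walk_le_ker]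
    simp only [bot_le, if_true]
    have := walk_finrank_ne_le hp0 hp hε0 L (⊥ : Submodule K (Fin n → K)) L.length (by simp) hdep
    linarith

end Core

theorem mul_rpow_mul_rpow_le {a b c s C Q : ℝ} {n : ℕ} (hC : 1 ≤ C) (hQ : 1 ≤ Q)
    (ha : a ≤ 2 ^ n) (hb : b ≤ 2 * n) (hc : c ≤ -s) :
    a * (C ^ b * Q ^ c) ≤ 2 ^ n * (C ^ (2 * n : ℝ) * Q ^ (-s)) := by
  have h1 := Real.rpow_le_rpow_of_exponent_le hC hb
  have h2 := Real.rpow_le_rpow_of_exponent_le hQ hc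
  have hC0 : 0 < C := by linarith
  have hQ0 : 0 < Q := by linarith
  gcongr

theorem div_rpow_eq {C Q : ℝ} (hC : 0 ≤ C) (hQ : 0 ≤ Q) (s : ℝ) :
    (C / Q) ^ s = C ^ s * Q ^ (-s) := by
  rw [Real.div_rpow hC hQ, Real.rpow_neg hQ, div_eq_mul_inv]

theorem pow_le_rpow {ε s : ℝ} {k : ℕ} (h0 : 0 < ε) (h1 : ε ≤ 1) (hk : s ≤ k) : ε ^ k ≤ ε ^ s := by
  rw [← Real.rpow_natCast]
  exact Real.rpow_le_rpow_of_exponent_ge h0 h1 hk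

theorem countP_finRange {n : ℕ} (P : Fin n → Prop) [DecidablePred P] :
    (List.finRange n).countP (fun j => P j) = (Finset.univ.filter P).card := by
  rw [Finset.card_def, Finset.filter_val, ← Multiset.countP_eq_card_filter, Fin.univ_def]
  exact (Multiset.coe_countP _ _).symm

section Core

variable {K : Type*} [Field K] [Fintype K] {n : ℕ} {p : Fin n → (Fin n → K) → ℝ}
  {F : Fin n → Finset (Fin n)} {α C : ℝ}

theorem IndexCondition.le_countP_take (hF : IndexCondition α F) (i : Fin n) {r : ℕ}
    (hr : (r : ℝ) ≤ 2 * (α * n)) (hrn : r ≤ n) [∀ j, Decidable (i ∉ F j)] :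
    10 * (α * n) ≤ (((List.finRange n).take (n - r)).countP fun j => i ∉ F j : ℕ) := by
  classical
  have h1 : (List.finRange n).countP (fun j => i ∉ F j) =
      ((List.finRange n).take (n - r)).countP (fun j => i ∉ F j) +
        ((List.finRange n).drop (n - r)).countP (fun j => i ∉ F j) := by
    rw [← List.countP_append, List.take_append_drop]
  have h2 : ((List.finRange n).drop (n - r)).countP (fun j => i ∉ F j) ≤ r := by
    refine List.countP_le_length.trans ?_
    rw [List.length_drop, List.length_finRange]; omega
  rw [countP_finRange] at h1
  have h3 := Finset.card_filter_add_card_filter_not (s := (Finset.univ : Finset (Fin n)))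
    fun j => i ∈ F j
  rw [Finset.card_univ, Fintype.card_fin, h1] at h3
  have h4 := hF.mem_le i
  have h5 : (n : ℝ) ≤ ((Finset.univ.filter fun j => i ∈ F j).card : ℝ) +
      (((List.finRange n).take (n - r)).countP fun j => i ∉ F j : ℕ) + r := by
    exact_mod_cast (by omega)
  linarith

open Classical in
theorem sum_prod_ker_sparse_le [Fintype (Module.Dual K (Fin n → K))] (hC : 1 ≤ C)
    (hCq : C ≤ Fintype.card K) (hα : 0 < α) (hα' : α < 1 / 12) (hF : IndexCondition α F)
    (hp0 : ∀ j x, 0 ≤ p j x) (hp : ∀ j, ∑ x, p j x = 1)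
    (hs : ∀ j, IsSpread (p j) (C / (Fintype.card K : ℝ)) (F j)) {r : ℕ}
    (hr : (r : ℝ) ≤ 2 * (α * n)) (hrn : r ≤ n) :
    ∑ w ∈ Finset.univ.filter (fun w : Module.Dual K (Fin n → K) =>
        w ≠ 0 ∧ ((formSupport w).card : ℝ) < α * n),
      (((List.finRange n).take (n - r)).map fun j =>
        ∑ x, if x ∈ LinearMap.ker w then p j x else 0).prod ≤
      2 ^ n * (C ^ (2 * n : ℝ) * (Fintype.card K : ℝ) ^ (-(α * n))) := by
  set Q : ℝ := (Fintype.card K : ℝ) with hQ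
  have hQ1 : 1 ≤ Q := hC.trans hCq
  have hQ0 : 0 < Q := by linarith
  have hs0 : 0 ≤ α * n := by positivity
  have hε0 : 0 < C / Q := by positivity
  have hε1 : C / Q ≤ 1 := (div_le_one hQ0).2 hCq
  have hterm : ∀ w ∈ Finset.univ.filter (fun w : Module.Dual K (Fin n → K) =>
        w ≠ 0 ∧ ((formSupport w).card : ℝ) < α * n),
      (((List.finRange n).take (n - r)).map fun j =>
        ∑ x, if x ∈ LinearMap.ker w then p j x else 0).prod ≤ (C / Q) ^ (10 * (α * n)) := by
    intro w hw
    obtain ⟨i, hi⟩ := formSupport_nonempty (Finset.mem_filter.1 hw).2.1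
    refine (prod_ker_le hp0 hp hs _ w).trans (pow_le_rpow hε0 hε1 ?_)
    refine (hF.le_countP_take i hr hrn).trans ?_
    have : ((List.finRange n).take (n - r)).countP (fun j => i ∉ F j) ≤
        ((List.finRange n).take (n - r)).countP (fun j => ¬ formSupport w ⊆ F j) :=
      List.countP_mono_left fun j _ hj => by
        simp only [decide_eq_true_eq] at hj ⊢
        exact fun h => hj (h hi)
    exact_mod_cast this
  have hcard : ((Finset.univ.filter (fun w : Module.Dual K (Fin n → K) =>
        w ≠ 0 ∧ ((formSupport w).card : ℝ) < α * n)).card : ℝ) ≤ 2 ^ n * Q ^ (α * n) := by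
    refine le_trans ?_ (card_formSupport_lt_le (α * n))
    have : ∀ w : Module.Dual K (Fin n → K), w ≠ 0 ∧ ((formSupport w).card : ℝ) < α * n →
        ((formSupport w).card : ℝ) < α * n := fun _ => And.right
    exact_mod_cast Finset.card_le_card (Finset.monotone_filter_right _ fun w _ => this w)
  refine (Finset.sum_le_card_nsmul _ _ _ hterm).trans ?_
  rw [nsmul_eq_mul]
  refine (mul_le_mul_of_nonneg_right hcard (by positivity)).trans ?_
  have e : 2 ^ n * Q ^ (α * n) * (C / Q) ^ (10 * (α * n)) =
      2 ^ n * (C ^ (10 * (α * n)) * Q ^ (-(9 * (α * n)))) := by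
    have : -(9 * (α * n)) = α * n + -(10 * (α * n)) := by ring
    rw [div_rpow_eq (by linarith) hQ0.le, this, Real.rpow_add hQ0]; ring
  rw [e]
  refine mul_rpow_mul_rpow_le hC hQ1 le_rfl ?_ (by linarith)
  have : α * n ≤ 1 / 12 * n := mul_le_mul_of_nonneg_right hα'.le (Nat.cast_nonneg n)
  have : (0 : ℝ) ≤ n := Nat.cast_nonneg n
  linarith

open Classical in
theorem sum_prod_ker_structured_le [Fintype (Module.Dual K (Fin n → K))] {ψ : AddChar K ℂ}
    (hψ : ∃ a, ψ a ≠ 1) (hC : 1 ≤ C)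
    (hCq : C ≤ Fintype.card K) (hα : 0 < α) (hα' : α < 1 / 12) (hF : IndexCondition α F)
    (hp0 : ∀ j x, 0 ≤ p j x) (hp : ∀ j, ∑ x, p j x = 1)
    (hs : ∀ j, IsSpread (p j) (C / (Fintype.card K : ℝ)) (F j)) {r : ℕ}
    (hr : (r : ℝ) ≤ 2 * (α * n)) (hrn : r ≤ n) :
    ∑ w ∈ Finset.univ.filter (fun w : Module.Dual K (Fin n → K) =>
        α * n ≤ ((formSupport w).card : ℝ) ∧
          ∃ j, (Fintype.card K : ℝ) ^ (-(n / 4 : ℝ)) < ‖fourierCoeff ψ (p j) w‖),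
      (((List.finRange n).take (n - r)).map fun j =>
        ∑ x, if x ∈ LinearMap.ker w then p j x else 0).prod ≤
      2 ^ n * (C ^ (2 * n : ℝ) * (Fintype.card K : ℝ) ^ (-(α * n))) := by
  set Q : ℝ := (Fintype.card K : ℝ) with hQ
  set η : ℝ := Q ^ (-(n / 4 : ℝ)) with hη
  have hQ1 : 1 ≤ Q := hC.trans hCq
  have hQ0 : 0 < Q := by linarith
  have hη0 : 0 < η := by positivity
  have hs0 : 0 ≤ α * n := by positivity
  have hε0 : 0 < C / Q := by positivity
  have hε1 : C / Q ≤ 1 := (div_le_one hQ0).2 hCq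
  have hFn : ∀ j, (F j).card ≤ n := fun j => (Finset.card_le_univ _).trans (by simp)
  have hterm : ∀ w ∈ Finset.univ.filter (fun w : Module.Dual K (Fin n → K) =>
        α * n ≤ ((formSupport w).card : ℝ) ∧ ∃ j, η < ‖fourierCoeff ψ (p j) w‖),
      (((List.finRange n).take (n - r)).map fun j =>
        ∑ x, if x ∈ LinearMap.ker w then p j x else 0).prod ≤ (C / Q) ^ (n - 2 * (α * n)) := by
    intro w hw
    refine (prod_ker_le hp0 hp hs _ w).trans (pow_le_rpow hε0 hε1 ?_)
    have : ((List.finRange n).take (n - r)).countP (fun j => ¬ formSupport w ⊆ F j) = n - r := by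
      rw [List.countP_eq_length.2 fun j _ => ?_]
      · simp
      · simp only [decide_eq_true_eq]
        intro h
        have h1 : ((formSupport w).card : ℝ) ≤ (F j).card := by exact_mod_cast Finset.card_le_card h
        linarith [hF.card_lt j, (Finset.mem_filter.1 hw).2.1]
    rw [this, Nat.cast_sub hrn]
    linarith
  have hcard : ((Finset.univ.filter (fun w : Module.Dual K (Fin n → K) =>
        α * n ≤ ((formSupport w).card : ℝ) ∧ ∃ j, η < ‖fourierCoeff ψ (p j) w‖)).card : ℝ) ≤
      n * (Q ^ n * (C / Q) ^ (n - α * n) / η ^ 2) := by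
    have hj : ∀ j, ((Finset.univ.filter fun w : Module.Dual K (Fin n → K) =>
        η < ‖fourierCoeff ψ (p j) w‖).card : ℝ) ≤ Q ^ n * (C / Q) ^ (n - α * n) / η ^ 2 :=
      fun j => by
        have := card_fourierCoeff_gt_le hψ (hp0 j) (hp j) hη0
          (ε := (C / Q) ^ (n - α * n)) fun x => ((hs j).apply_le x).trans
            (pow_le_rpow hε0 hε1 (by
              rw [Nat.cast_sub (hFn j)]
              linarith [hF.card_lt j]))
        rwa [Module.finrank_fin_fun] at this
    have hsub : (Finset.univ.filter (fun w : Module.Dual K (Fin n → K) =>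
        α * n ≤ ((formSupport w).card : ℝ) ∧ ∃ j, η < ‖fourierCoeff ψ (p j) w‖)) ⊆
        Finset.univ.biUnion fun j => Finset.univ.filter fun w : Module.Dual K (Fin n → K) =>
          η < ‖fourierCoeff ψ (p j) w‖ := by
      intro w hw
      simpa using (Finset.mem_filter.1 hw).2.2
    calc _ ≤ ((∑ j, (Finset.univ.filter fun w : Module.Dual K (Fin n → K) =>
          η < ‖fourierCoeff ψ (p j) w‖).card : ℕ) : ℝ) := by
          exact_mod_cast (Finset.card_le_card hsub).trans Finset.card_biUnion_le
      _ ≤ _ := by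
          push_cast
          refine (Finset.sum_le_card_nsmul _ _ _ fun j _ => hj j).trans ?_
          simp
  refine (Finset.sum_le_card_nsmul _ _ _ hterm).trans ?_
  rw [nsmul_eq_mul]
  refine (mul_le_mul_of_nonneg_right hcard (by positivity)).trans ?_
  have e : n * (Q ^ n * (C / Q) ^ (n - α * n) / η ^ 2) * (C / Q) ^ (n - 2 * (α * n)) =
      n * (C ^ (2 * n - 3 * (α * n)) * Q ^ (3 * (α * n) - n / 2)) := by
    have e1 : (η ^ 2)⁻¹ = Q ^ (n / 2 : ℝ) := by
      rw [hη, ← Real.rpow_natCast, ← Real.rpow_mul hQ0.le, ← Real.rpow_neg hQ0.le]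
      congr 1; push_cast; ring
    have e2 : 3 * (α * n) - n / 2 =
        n + -(n - α * n) + n / 2 + -(n - 2 * (α * n)) := by ring
    have e3 : 2 * n - 3 * (α * n) = (n - α * n) + (n - 2 * (α * n)) := by ring
    rw [div_eq_mul_inv _ (η ^ 2), e1, div_rpow_eq (by linarith) hQ0.le,
      div_rpow_eq (by linarith) hQ0.le, e2, e3, Real.rpow_add (by linarith : 0 < C),
      Real.rpow_add hQ0, Real.rpow_add hQ0, Real.rpow_add hQ0, Real.rpow_natCast]
    ring
  rw [e]
  have h1 : α * n ≤ 1 / 12 * n := mul_le_mul_of_nonneg_right hα'.le (Nat.cast_nonneg n)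
  have h2 : (0 : ℝ) ≤ n := Nat.cast_nonneg n
  exact mul_rpow_mul_rpow_le hC hQ1 (by exact_mod_cast Nat.lt_two_pow_self.le)
    (by linarith) (by linarith)

theorem abs_walk_finRange_sub_tsum_le (hn : 0 < n) (hC : 1 ≤ C) (hCq : C ≤ Fintype.card K)
    (hα : 0 < α) (hα' : α < 1 / 12) (hF : IndexCondition α F)
    (hp0 : ∀ j x, 0 ≤ p j x) (hp : ∀ j, ∑ x, p j x = 1)
    (hs : ∀ j, IsSpread (p j) (C / (Fintype.card K : ℝ)) (F j)) {h : ℕ → ℝ}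
    (hh : ∀ d, h d ∈ Set.Icc (0 : ℝ) 1) :
    |walk p (List.finRange n) (fun U : Submodule K (Fin n → K) =>
        h (Module.finrank K (Fin n → K) - Module.finrank K U)) ⊥ -
      ∑' k, auxMass (1 / (Fintype.card K : ℝ)) 0 k * h k| ≤
      5 * (2 ^ n * (C ^ (2 * n : ℝ) * (Fintype.card K : ℝ) ^ (-(α * n)))) := by
  classical
  have : Finite (Module.Dual K (Fin n → K)) := Finite.of_injective _ DFunLike.coe_injective
  let _ : Fintype (Module.Dual K (Fin n → K)) := Fintype.ofFinite _
  obtain ⟨ψ, hψ⟩ := exists_addChar_ne_one K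
  set Q : ℝ := (Fintype.card K : ℝ) with hQ
  set η : ℝ := Q ^ (-(n / 4 : ℝ)) with hη
  have hQ1 : 1 ≤ Q := hC.trans hCq
  have hQ0 : 0 < Q := by linarith
  have hQ2 : 2 ≤ Q := by
    rw [hQ]; exact_mod_cast (Fintype.one_lt_card : 1 < Fintype.card K)
  have hε0 : 0 < C / Q := by positivity
  have hε1 : C / Q ≤ 1 := (div_le_one hQ0).2 hCq
  have hn0 : (0 : ℝ) ≤ n := Nat.cast_nonneg n
  have hn2 : (n : ℝ) ≤ 2 ^ n := by exact_mod_cast Nat.lt_two_pow_self.le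
  have hs0 : 0 ≤ α * n := by positivity
  have hs1 : α * n ≤ 1 / 12 * n := mul_le_mul_of_nonneg_right hα'.le hn0
  set r : ℕ := ⌊2 * (α * n)⌋₊ with hr
  have hr1 : (r : ℝ) ≤ 2 * (α * n) := Nat.floor_le (by positivity)
  have hr2 : 2 * (α * n) < r + 1 := Nat.lt_floor_add_one _
  have hrn' : (r : ℝ) ≤ n := by linarith
  have hrn : r ≤ n := by exact_mod_cast hrn'
  set L := (List.finRange n).take (n - r) with hL
  set L' := (List.finRange n).drop (n - r) with hL'
  have hLL : L ++ L' = List.finRange n := List.take_append_drop _ _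
  have hl : L.length = n - r := by simp [hL]
  have hl' : L'.length = r := by simp [hL']; omega
  have hdep : ∀ j ∈ L, ∀ U : Submodule K (Fin n → K), Module.finrank K U < L.length →
      (∑ x, if x ∈ U then p j x else 0) ≤ (C / Q) ^ (α * n) := fun j _ U hU => by
    refine ((hs j).sum_submodule_le hε0.le hε1 U).trans (pow_le_rpow hε0 hε1 ?_)
    have h1 : r + 1 ≤ (n - Module.finrank K U - (F j).card) + (F j).card := by omega
    have h2 : (r : ℝ) + 1 ≤ ((n - Module.finrank K U - (F j).card : ℕ) : ℝ) + (F j).card := by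
      exact_mod_cast h1
    linarith [hF.card_lt j]
  set B₁ := Finset.univ.filter (fun w : Module.Dual K (Fin n → K) =>
    w ≠ 0 ∧ ((formSupport w).card : ℝ) < α * n) with hB₁
  set B₂ := Finset.univ.filter (fun w : Module.Dual K (Fin n → K) =>
    α * n ≤ ((formSupport w).card : ℝ) ∧ ∃ j, η < ‖fourierCoeff ψ (p j) w‖) with hB₂
  have hdis : Disjoint B₁ B₂ := Finset.disjoint_left.2 fun w h1 h2 => by
    have h3 := (Finset.mem_filter.1 h1).2.2
    have h4 := (Finset.mem_filter.1 h2).2.1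
    linarith
  have key := abs_walk_append_sub_iterate_le hψ hp0 hp (Real.rpow_nonneg hε0.le (α * n))
    (η := η) (by positivity) hh L L' (by omega) hdep (B₁ ∪ B₂) fun w hw hw0 j _ => by
      by_contra! hj
      simp only [hB₁, hB₂, Finset.mem_union, Finset.mem_filter, Finset.mem_univ, true_and,
        not_or, not_and, not_lt] at hw
      exact hw.2 (hw.1 hw0) ⟨j, hj⟩
  rw [hLL, hl', hl, Finset.sum_union hdis, ← hQ] at key
  have t2 := sum_prod_ker_sparse_le hC hCq hα hα' hF hp0 hp hs hr1 hrn
  have t3 := sum_prod_ker_structured_le hψ hC hCq hα hα' hF hp0 hp hs hr1 hrn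
  have hx : 1 / Q ≤ 1 / 2 := one_div_le_one_div_of_le two_pos hQ2
  have t5 := abs_tsum_auxMass_sub_iterate_le (by positivity) hx hh r
  set T : ℝ := 2 ^ n * (C ^ (2 * n : ℝ) * Q ^ (-(α * n))) with hT
  have b1 : ((n - r : ℕ) : ℝ) * (C / Q) ^ (α * n) ≤ T := by
    rw [div_rpow_eq (by linarith) hQ0.le]
    refine mul_rpow_mul_rpow_le hC hQ1 (le_trans ?_ hn2) (by linarith) le_rfl
    exact_mod_cast Nat.sub_le _ _
  have b4 : (r : ℝ) * η ≤ T := by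
    have := mul_rpow_mul_rpow_le (b := 0) (c := -(n / 4 : ℝ)) (s := α * n) hC hQ1
      (hrn'.trans hn2) (by linarith) (by linarith)
    rwa [Real.rpow_zero, one_mul] at this
  have b5 : 2 * (1 / Q) ^ (r + 1) ≤ T := by
    have h1 := mul_rpow_mul_rpow_le (a := 2) (n := n) (b := 0) (c := -(2 * (α * n))) (s := α * n)
      hC hQ1 (le_self_pow₀ one_le_two hn.ne') (by linarith) (by linarith)
    rw [Real.rpow_zero, one_mul] at h1
    refine le_trans (mul_le_mul_of_nonneg_left ?_ two_pos.le) h1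
    rw [Real.rpow_neg hQ0.le, ← Real.inv_rpow hQ0.le, ← one_div]
    exact pow_le_rpow (by positivity) (by linarith) (by push_cast; linarith)
  rw [abs_sub_comm] at t5
  have := abs_sub_le (walk p (List.finRange n) (fun U : Submodule K (Fin n → K) =>
        h (Module.finrank K (Fin n → K) - Module.finrank K U)) ⊥)
    ((idealStep (1 / Q))^[r] h r) (∑' k, auxMass (1 / Q) 0 k * h k)
  linarith

end Core

end RankDist

theorem theorem1p3 :
    ∃ α₀ : ℝ, 0 < α₀ ∧ ∀ C α : ℝ, 1 ≤ C → 0 < α → α < α₀ →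
      ∃ C' c : ℝ, 0 < C' ∧ 0 < c ∧
        ∀ (K : Type*) [Field K] [Fintype K] [MeasurableSpace K] [MeasurableSingletonClass K]
          (Ω : Type*) [MeasurableSpace Ω] (P : Measure Ω) [IsProbabilityMeasure P]
          (n : ℕ) (F : Fin n → Finset (Fin n)) (X : Fin n → Ω → Fin n → K),
          RankDist.IndexCondition α F →
          (∀ j, Measurable (X j)) →
          iIndepFun X P →
          (∀ j, RankDist.IsNearUniformOfType P C (F j) (X j)) →
          RankDist.tvDist (P.map fun ω => RankDist.corank fun j => X j ω)
              (RankDist.limitLaw (Fintype.card K) Fintype.one_lt_card).toMeasure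
            ≤ (C' / (Fintype.card K : ℝ)) ^ (c * n) := by
  refine ⟨1 / 12, by norm_num, fun C α hC hα hα' => ⟨(10 * C ^ 2) ^ (1 / α), α, by positivity, hα,
    fun K _ _ _ _ Ω _ P _ n F X hF hX hi hU => ?_⟩⟩
  have : Nonempty {A : Set ℕ // MeasurableSet A} := ⟨⟨∅, .empty⟩⟩
  refine ciSup_le fun ⟨A, hA⟩ => ?_
  have hC2 : 1 ≤ 10 * C ^ 2 := by nlinarith
  have hQ0 : (0 : ℝ) < Fintype.card K := by exact_mod_cast Fintype.card_pos
  have hbound : ((10 * C ^ 2) ^ (1 / α) / (Fintype.card K : ℝ)) ^ (α * n) =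
      (10 * C ^ 2) ^ n * (Fintype.card K : ℝ) ^ (-(α * n)) := by
    have e : 1 / α * (α * n) = n := by field_simp
    rw [RankDist.div_rpow_eq (by positivity) hQ0.le, ← Real.rpow_mul (by positivity), e,
      Real.rpow_natCast]
  have hmap : IsProbabilityMeasure (P.map fun ω => RankDist.corank fun j => X j ω) :=
    Measure.isProbabilityMeasure_map
      ((measurable_of_countable (RankDist.corank : (Fin n → Fin n → K) → ℕ)).comp
        (measurable_pi_lambda (fun ω j => X j ω) hX)).aemeasurable
  have htriv : |(P.map fun ω => RankDist.corank fun j => X j ω).real A -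
      (RankDist.limitLaw (Fintype.card K) Fintype.one_lt_card).toMeasure.real A| ≤ 1 := by
    have h1 := measureReal_le_one (μ := P.map fun ω => RankDist.corank fun j => X j ω) (s := A)
    have h2 := measureReal_le_one
      (μ := (RankDist.limitLaw (Fintype.card K) Fintype.one_lt_card).toMeasure) (s := A)
    rw [abs_le]
    constructor <;> linarith [measureReal_nonneg
      (μ := P.map fun ω => RankDist.corank fun j => X j ω) (s := A), measureReal_nonneg
      (μ := (RankDist.limitLaw (Fintype.card K) Fintype.one_lt_card).toMeasure) (s := A)]
  rcases n.eq_zero_or_pos with rfl | hn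
  · simpa using htriv
  have hn0 : (0 : ℝ) ≤ n := Nat.cast_nonneg n
  rw [hbound]
  rcases le_or_gt C (Fintype.card K) with hCq | hCq
  · have h01 : ∀ d, A.indicator (fun _ => (1 : ℝ)) d ∈ Set.Icc (0 : ℝ) 1 := fun d => by
      by_cases hd : d ∈ A <;> simp [hd]
    rw [RankDist.real_map_corank_eq_walk hX hi, RankDist.real_toMeasure_limitLaw]
    refine (RankDist.abs_walk_finRange_sub_tsum_le hn hC hCq hα hα' hF
      (fun _ _ => measureReal_nonneg) (fun j => RankDist.sum_real_fiber_eq_one (hX j))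
      (fun j => (hU j).isSpread (hX j)) h01).trans ?_
    have e : C ^ (2 * n : ℝ) = (C ^ 2) ^ n := by
      rw [← pow_mul, ← Real.rpow_natCast]; push_cast; rfl
    rw [e, ← mul_assoc, ← mul_assoc]
    refine mul_le_mul_of_nonneg_right ?_ (by positivity)
    have h5 : (5 : ℝ) ≤ 5 ^ n := le_self_pow₀ (by norm_num) hn.ne'
    calc 5 * 2 ^ n * (C ^ 2) ^ n ≤ 5 ^ n * 2 ^ n * (C ^ 2) ^ n := by gcongr
      _ = _ := by rw [← mul_pow, ← mul_pow]; norm_num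
  · refine htriv.trans ?_
    have hQ1 : (1 : ℝ) ≤ Fintype.card K := by exact_mod_cast Fintype.card_pos
    have h1 : (Fintype.card K : ℝ) ^ (α * n) ≤ (10 * C ^ 2) ^ n := by
      rw [← Real.rpow_natCast]
      calc (Fintype.card K : ℝ) ^ (α * n) ≤ (Fintype.card K : ℝ) ^ (n : ℝ) :=
            Real.rpow_le_rpow_of_exponent_le hQ1 (by nlinarith)
        _ ≤ _ := Real.rpow_le_rpow hQ0.le (by nlinarith) hn0
    rw [Real.rpow_neg hQ0.le, ← div_eq_mul_inv, le_div_iff₀ (by positivity), one_mul]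
    exact h1
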